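/- Let $H$ be a complex Hilbert space and let $\mathcal{CF}^{sa}(H)$ be the set of (in general unbounded, densely defined) selfadjoint Fredholm operators on $H$, where a closed operator is Fredholm if its kernel is finite dimensional and its image has finite codimension. Equip $\mathcal{CF}^{sa}(H)$ with the gap metric $d_G(T,S)=\|\kappa(T)-\kappa(S)\|$, where $\kappa(T)=(T-i)(T+i)^{-1}$ is the Cayley transform, and let $I=[0,1]$. For real $c<d$ in the resolvent set $\rho(T)$ let $\chi_{[c,d]}(T)=\frac{1}{2\pi i}\int_\Gamma(\lambda-T)^{-1}\,d\lambda$, where $\Gamma$ is the circle of radius $\frac{d-c}{2}$ around $\frac{c+d}{2}$, and let $E_{[c,d]}(T)=\bigoplus_{\mu\in[c,d]}\ker(\mu-T)$. For a gap continuous path $\mathcal{A}:I\to\mathcal{CF}^{sa}(H)$, call points $0=\lambda_0\le\lambda_1\le\dots\le\lambda_n=1$ together with numbers $a_1,\dots,a_n>0$ admissible if for each $i$ one has $\pm a_i\in\rho(\mathcal{A}_\lambda)$ for all $\lambda\in[\lambda_{i-1},\lambda_i]$, and $\lambda\mapsto\chi_{[-a_i,a_i]}(\mathcal{A}_\lambda)$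 is norm continuous and of constant finite rank on $[\lambda_{i-1},\lambda_i]$. The spectral flow of $\mathcal{A}$ is $$\mathrm{sfl}(\mathcal{A})=\sum_{i=1}^n\bigl(\dim E_{[0,a_i]}(\mathcal{A}_{\lambda_i})-\dim E_{[0,a_i]}(\mathcal{A}_{\lambda_{i-1}})\bigr)\in\mathbb{Z}$$ for any admissible choice. Then the spectral flow is well defined, that is, admissible choices exist for every gap continuous path and the sum does not depend on the choice, and the following hold. (i) If $\mathcal{A}^1,\mathcal{A}^2:I\to\mathcal{CF}^{sa}(H)$ are gap continuous with $\mathcal{A}^2_0=\mathcal{A}^1_1$, and $\mathcal{A}^1\ast\mathcal{A}^2$ denotes their concatenation, then $\mathrm{sfl}(\mathcal{A}^1\ast\mathcal{A}^2)=\mathrm{sfl}(\mathcal{A}^1)+\mathrm{sfl}(\mathcal{A}^2)$. (ii) If $\mathcal{A}:I\to\mathcal{CF}^{sa}(H)$ is gap continuous and $\mathcal{A}'_t=\mathcal{A}_{1-t}$, then $\mathrm{sfl}(\mathcal{A}')=-\mathrm{sfl}(\mathcal{A})$. (iii) If $\mathcal{A}:I\to\mathcal{CF}^{sa}(H)$ is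 gap continuous and every $\mathcal{A}_t$ maps its domain bijectively onto $H$, then $\mathrm{sfl}(\mathcal{A})=0$. -/

import Mathlib

noncomputable section

namespace SpecFlow

open scoped unitInterval

variable {H : Type*} [NormedAddCommGroup H] [InnerProductSpace ℂ H]

/-- The operator `z - T`, with domain `D(T)`. -/
def shift (T : H →ₗ.[ℂ] H) (z : ℂ) : T.domain →ₗ[ℂ] H :=
  z • T.domain.subtype - T.toFun

/-- `T` maps its domain bijectively onto `H`. -/
def IsInvertible (T : H →ₗ.[ℂ] H) : Prop :=
  Function.Bijective T.toFun

/-- Fredholm operator: a closed operator with finite dimensional kernel and with image of finite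
codimension. -/
def IsFredholm (T : H →ₗ.[ℂ] H) : Prop :=
  T.IsClosed ∧ FiniteDimensional ℂ (LinearMap.ker T.toFun) ∧
    FiniteDimensional ℂ (H ⧸ LinearMap.range T.toFun)

/-- The bounded operator `R` on `H` is a two-sided inverse of `z - T : D(T) → H`. -/
def IsResolventAt (T : H →ₗ.[ℂ] H) (z : ℂ) (R : H →L[ℂ] H) : Prop :=
  (∀ u : T.domain, R (shift T z u) = u) ∧ ∀ v : H, ∃ u : T.domain, (u : H) = R v ∧ shift T z u = v

/-- The resolvent set of `T`: those `z` for which `z - T` is bijective with bounded inverse. -/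
def resSet (T : H →ₗ.[ℂ] H) : Set ℂ :=
  {z | ∃ R : H →L[ℂ] H, IsResolventAt T z R}

open scoped Classical in
/-- The resolvent `(z - T)⁻¹`, for `z` in the resolvent set (and `0` otherwise). -/
def res (T : H →ₗ.[ℂ] H) (z : ℂ) : H →L[ℂ] H :=
  if h : ∃ R : H →L[ℂ] H, IsResolventAt T z R then h.choose else 0

/-- The Cayley transform `(T - i)(T + i)⁻¹`, written as `1 - 2i (T + i)⁻¹`, where
`(T + i)⁻¹ = - (-i - T)⁻¹`. See `cayley_apply` for the product form. -/
def cayley (T : H →ₗ.[ℂ] H) : H →L[ℂ] H :=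
  ContinuousLinearMap.id ℂ H - (2 * Complex.I) • (-res T (-Complex.I))

/-- The spectral projection `(2πi)⁻¹ ∮ (z - T)⁻¹ dz`, the integral being over the circle of radius
`(b - a) / 2` around `(a + b) / 2`. -/
def spectralProj (T : H →ₗ.[ℂ] H) (a b : ℝ) : H →L[ℂ] H :=
  (2 * Real.pi * Complex.I : ℂ)⁻¹ •
    circleIntegral (fun z => res T z) ((((a + b) / 2 : ℝ)) : ℂ) ((b - a) / 2)

/-- `ker (z - T)`, as a subspace of `H`. -/
def eigenspace (T : H →ₗ.[ℂ] H) (z : ℂ) : Submodule ℂ H :=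
  (LinearMap.ker (shift T z)).map T.domain.subtype

/-- `E_{[c,d]}(T)`: the (automatically direct) sum in `H` of the spaces `ker (μ - T)` over the real
numbers `μ` in `[c,d]`. -/
def eigensum (T : H →ₗ.[ℂ] H) (c d : ℝ) : Submodule ℂ H :=
  ⨆ μ ∈ Set.Icc c d, eigenspace T ((μ : ℝ) : ℂ)

theorem res_spec {T : H →ₗ.[ℂ] H} {z : ℂ} (hz : z ∈ resSet T) : IsResolventAt T z (res T z) := by
  have h : ∃ R : H →L[ℂ] H, IsResolventAt T z R := hz
  rw [res, dif_pos h]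
  exact h.choose_spec

variable [CompleteSpace H]

theorem norm_sq_shift {T : H →ₗ.[ℂ] H} (hT : IsSelfAdjoint T) {c : ℂ} (hre : c.re = 0)
    (hc : ‖c‖ = 1) (u : T.domain) : ‖shift T c u‖ ^ 2 = ‖T u‖ ^ 2 + ‖(u : H)‖ ^ 2 := by
  have hsym : inner ℂ (T u) (u : H) = inner ℂ (u : H) (T u) := by
    have h := LinearPMap.adjoint_isFormalAdjoint hT.dense_domain
    rw [LinearPMap.isSelfAdjoint_def.mp hT] at h
    exact h u u
  have hreal : (inner ℂ (u : H) (T u)).im = 0 := by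
    rw [← inner_conj_symm] at hsym
    have := congrArg Complex.im hsym
    simp only [Complex.conj_im] at this
    linarith
  have hs : shift T c u = c • (u : H) - T u := rfl
  rw [hs, @norm_sub_sq ℂ, norm_smul, hc, inner_smul_left]
  have : RCLike.re ((starRingEnd ℂ) c * inner ℂ (u : H) (T u)) = 0 := by
    change ((starRingEnd ℂ) c * inner ℂ (u : H) (T u)).re = 0
    rw [Complex.mul_re, hreal, Complex.conj_re, hre]
    ring
  rw [this]
  ring

theorem neg_I_mem_resSet {T : H →ₗ.[ℂ] H} (hT : IsSelfAdjoint T) : -Complex.I ∈ resSet T := by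
  have hnorm := norm_sq_shift hT (c := -Complex.I) (by simp) (by simp)
  have hle : ∀ u : T.domain, ‖(u : H)‖ ≤ ‖shift T (-Complex.I) u‖ := fun u =>
    le_of_sq_le_sq (by rw [hnorm u]; nlinarith [sq_nonneg ‖T u‖]) (norm_nonneg _)
  have hinj : Function.Injective (shift T (-Complex.I)) := by
    rw [injective_iff_map_eq_zero]
    intro u hu
    have := hle u
    rw [hu, norm_zero] at this
    exact Subtype.ext (norm_le_zero_iff.mp this)
  have hclosed : IsClosed ((LinearMap.range (shift T (-Complex.I)) : Submodule ℂ H) : Set H) := by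
    rw [← isSeqClosed_iff_isClosed]
    intro x y hx hxy
    choose u hu using hx
    have hcu : CauchySeq (fun n => (u n : H)) := by
      rw [Metric.cauchySeq_iff']
      intro ε hε
      obtain ⟨N, hN⟩ := Metric.cauchySeq_iff'.mp hxy.cauchySeq ε hε
      refine ⟨N, fun n hn => lt_of_le_of_lt ?_ (hN n hn)⟩
      rw [dist_eq_norm, dist_eq_norm, ← hu n, ← hu N, ← map_sub]
      exact hle (u n - u N)
    obtain ⟨w, hw⟩ := cauchySeq_tendsto_of_complete hcu
    have hTu : Filter.Tendsto (fun n => T (u n)) Filter.atTop (nhds (-Complex.I • w - y)) := by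
      have h1 := (hw.const_smul (-Complex.I)).sub hxy
      refine h1.congr fun n => ?_
      rw [← hu n]
      change -Complex.I • (u n : H) - (-Complex.I • (u n : H) - T (u n)) = _
      abel
    have hmem : (w, -Complex.I • w - y) ∈ (T.graph : Set (H × H)) :=
      (show IsClosed (T.graph : Set (H × H)) from hT.isClosed).isSeqClosed
        (x := fun n => ((u n : H), T (u n))) (fun n => T.mem_graph (u n)) (hw.prodMk_nhds hTu)
    obtain ⟨w', hw1, hw2⟩ := LinearPMap.mem_graph_iff T |>.mp hmem
    refine ⟨w', ?_⟩
    change -Complex.I • (w' : H) - T w' = y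
    rw [hw1, hw2, sub_sub_cancel]
  have hsurj : LinearMap.range (shift T (-Complex.I)) = ⊤ := by
    have : CompleteSpace (LinearMap.range (shift T (-Complex.I))) :=
      hclosed.completeSpace_coe
    rw [← Submodule.orthogonal_eq_bot_iff, Submodule.eq_bot_iff]
    intro w hw
    have horth : ∀ u : T.domain, inner ℂ (Complex.I • w) (u : H) = inner ℂ w (T u) := by
      intro u
      have h0 := Submodule.inner_left_of_mem_orthogonal
        (LinearMap.mem_range_self (shift T (-Complex.I)) u) hw
      change inner ℂ w (-Complex.I • (u : H) - T u) = 0 at h0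
      rw [inner_sub_right, inner_smul_right] at h0
      rw [inner_smul_left, Complex.conj_I]
      exact sub_eq_zero.mp h0
    have hmem : w ∈ (LinearPMap.adjoint T).domain :=
      LinearPMap.mem_adjoint_domain_of_exists w ⟨_, horth⟩
    have hval := LinearPMap.adjoint_apply_eq hT.dense_domain ⟨w, hmem⟩ horth
    have hg : (w, Complex.I • w) ∈ (LinearPMap.adjoint T).graph := by
      rw [← hval]
      exact LinearPMap.mem_graph _ (⟨w, hmem⟩ : (LinearPMap.adjoint T).domain)
    rw [LinearPMap.isSelfAdjoint_def.mp hT] at hg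
    obtain ⟨w', hw1, hw2⟩ := LinearPMap.mem_graph_iff T |>.mp hg
    have h2 := norm_sq_shift hT (c := Complex.I) (by simp) (by simp) w'
    have h3 : shift T Complex.I w' = 0 := by
      change Complex.I • (w' : H) - T w' = 0
      rw [hw1, hw2, sub_self]
    rw [h3, norm_zero, hw1] at h2
    have h4 : ‖w‖ = 0 := by nlinarith [sq_nonneg ‖T w'‖, sq_nonneg ‖w‖]
    exact norm_eq_zero.mp h4
  let e := LinearEquiv.ofBijective (shift T (-Complex.I)) ⟨hinj, LinearMap.range_eq_top.mp hsurj⟩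
  refine ⟨(T.domain.subtype ∘ₗ e.symm.toLinearMap).mkContinuous 1 fun v => ?_, ?_, ?_⟩
  · have := hle (e.symm v)
    rw [one_mul]
    refine this.trans (le_of_eq ?_)
    exact congrArg norm (e.apply_symm_apply v)
  · intro u
    exact congrArg Subtype.val (e.symm_apply_apply u)
  · intro v
    exact ⟨e.symm v, rfl, e.apply_symm_apply v⟩

/-- `cayley T = (T - i)(T + i)⁻¹`: if `v = (T + i) u` then `cayley T v = (T - i) u`. -/
theorem cayley_apply {T : H →ₗ.[ℂ] H} (hT : IsSelfAdjoint T) (u : T.domain) :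
    cayley T (T u + Complex.I • (u : H)) = T u - Complex.I • (u : H) := by
  have h := (res_spec (neg_I_mem_resSet hT)).1 u
  have hs : shift T (-Complex.I) u = -(T u + Complex.I • (u : H)) := by
    change -Complex.I • (u : H) - T u = _
    rw [neg_smul]
    abel
  rw [hs, map_neg] at h
  change T u + Complex.I • (u : H) -
    (2 * Complex.I) • (-res T (-Complex.I) (T u + Complex.I • (u : H))) = _
  rw [h, mul_smul, two_smul]
  abel

variable (H) in
/-- The set of selfadjoint Fredholm operators, in general unbounded, on the Hilbert space `H`.
(Selfadjoint operators are densely defined: `IsSelfAdjoint.dense_domain`.) -/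
structure CFsa where
  /-- the underlying partially defined operator -/
  op : H →ₗ.[ℂ] H
  /-- the operator equals its adjoint -/
  selfAdjoint : IsSelfAdjoint op
  /-- the operator is Fredholm -/
  fredholm : IsFredholm op

theorem cayley_injective : Function.Injective (fun T : CFsa H => cayley T.op) := by
  have key : ∀ T S : CFsa H, cayley T.op = cayley S.op → T.op ≤ S.op := by
    intro T S h
    have hres : res T.op (-Complex.I) = res S.op (-Complex.I) := by
      have h' : (2 * Complex.I) • (-res T.op (-Complex.I)) =
          (2 * Complex.I) • (-res S.op (-Complex.I)) := sub_right_injective h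
      have h2 : (2 * Complex.I : ℂ) ≠ 0 := by simp
      exact neg_injective (smul_right_injective _ h2 h')
    have hT := res_spec (neg_I_mem_resSet T.selfAdjoint)
    have hS := res_spec (neg_I_mem_resSet S.selfAdjoint)
    apply LinearPMap.le_of_le_graph
    rintro ⟨x, y⟩ hxy
    obtain ⟨u, hu1, hu2⟩ := LinearPMap.mem_graph_iff T.op |>.mp hxy
    obtain ⟨w, hw1, hw2⟩ := hS.2 (shift T.op (-Complex.I) u)
    rw [← hres, hT.1 u] at hw1
    refine LinearPMap.mem_graph_iff S.op |>.mpr ⟨w, hw1.trans hu1, ?_⟩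
    change -Complex.I • (w : H) - S.op w = -Complex.I • (u : H) - T.op u at hw2
    rw [hw1] at hw2
    exact (sub_right_injective hw2).trans hu2
  intro T S h
  have : T.op = S.op := le_antisymm (key T S h) (key S T h.symm)
  cases T
  cases S
  congr

/-- The gap metric `d(T, S) = ‖cayley T - cayley S‖`. -/
instance : MetricSpace (CFsa H) :=
  MetricSpace.induced (fun T : CFsa H => cayley T.op) cayley_injective inferInstance

theorem dist_eq (T S : CFsa H) : dist T S = ‖cayley T.op - cayley S.op‖ :=
  dist_eq_norm (cayley T.op) (cayley S.op)

/-- The points `0 = pt 0 ≤ pt 1 ≤ ⋯ ≤ pt n = 1` and the numbers `a 1, …, a n > 0` can be used to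
compute the spectral flow of `A`: for `i < n` and `t ∈ [pt i, pt (i + 1)]` the numbers
`± a (i + 1)` are in the resolvent set of `A t`, and the spectral projection of `A t` for the
interval `[-a (i + 1), a (i + 1)]` depends continuously on `t` and has constant, finite rank. -/
structure IsAdmissible (A : I → CFsa H) (n : ℕ) (pt : ℕ → I) (a : ℕ → ℝ) : Prop where
  pt_zero : pt 0 = 0
  pt_last : pt n = 1
  pt_le : ∀ i < n, pt i ≤ pt (i + 1)
  pos : ∀ i < n, 0 < a (i + 1)
  mem_resSet : ∀ i < n, ∀ t ∈ Set.Icc (pt i) (pt (i + 1)),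
    ((a (i + 1) : ℝ) : ℂ) ∈ resSet (A t).op ∧ ((-a (i + 1) : ℝ) : ℂ) ∈ resSet (A t).op
  continuousOn : ∀ i < n,
    ContinuousOn (fun t => spectralProj (A t).op (-a (i + 1)) (a (i + 1)))
      (Set.Icc (pt i) (pt (i + 1)))
  rank_finite : ∀ i < n, ∀ t ∈ Set.Icc (pt i) (pt (i + 1)),
    FiniteDimensional ℂ
      (LinearMap.range (spectralProj (A t).op (-a (i + 1)) (a (i + 1))).toLinearMap)
  rank_const : ∀ i < n, ∀ s ∈ Set.Icc (pt i) (pt (i + 1)), ∀ t ∈ Set.Icc (pt i) (pt (i + 1)),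
    Module.finrank ℂ
        (LinearMap.range (spectralProj (A s).op (-a (i + 1)) (a (i + 1))).toLinearMap) =
      Module.finrank ℂ
        (LinearMap.range (spectralProj (A t).op (-a (i + 1)) (a (i + 1))).toLinearMap)

/-- The sum over `i = 1, …, n` of `dim E_{[0, a i]}(A (pt i)) - dim E_{[0, a i]}(A (pt (i - 1)))`.
-/
def flowSum (A : I → CFsa H) (n : ℕ) (pt : ℕ → I) (a : ℕ → ℝ) : ℤ :=
  ∑ i ∈ Finset.range n,
    ((Module.finrank ℂ (eigensum (A (pt (i + 1))).op 0 (a (i + 1))) : ℤ) -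
      (Module.finrank ℂ (eigensum (A (pt i)).op 0 (a (i + 1))) : ℤ))

open scoped Classical in
/-- The spectral flow of `A`: the value of `flowSum` for any admissible data. (For gap continuous
paths such data exist and the value does not depend on them; if there are none the value is `0`.) -/
def sfl (A : I → CFsa H) : ℤ :=
  if h : ∃ k : ℤ, ∃ (n : ℕ) (pt : ℕ → I) (a : ℕ → ℝ), IsAdmissible A n pt a ∧ k = flowSum A n pt a
  then h.choose else 0

end SpecFlow

end

noncomputable section

namespace SpecFlow

open scoped Topology

open Complex Metric Set Filter

/-! ### Resolvents of an unbounded operator through bounded operators -/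

section Resolvent

variable {H : Type*} [NormedAddCommGroup H] [InnerProductSpace ℂ H]

/-! If `a` stays in the resolvent set, the dimension of the eigenspaces in `[0, a]` can change along
a path only by eigenvalues passing through `0`. The underlying stability fact is that, when `c < d`
are in the resolvent set, the Riesz projection for `[c, d]` is norm continuous in the gap metric
(`continuousOn_spectralProj`). Idempotents at distance less than one have equal rank as soon as one
rank is finite, so the rank is constant on connected parameter sets
(`finrank_range_spectralProj_eq`). A finite rank counts eigenvalues, because the projection then
maps onto the sum of the eigenspaces (`range_spectralProj_eq_eigensum`).

Admissible data exist because the resolvent of a selfadjoint Fredholm operator is, near `0`, a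
holomorphic term plus a term `P * (z⁻¹ • C z)` with `P` of finite rank. A small circle thus gives a
finite rank projection, the same `a` works for nearby operators (`isOpen_setOf_isCut`), and
compactness of the interval finishes.

For independence, changing `a` to `b > a` on one piece adds the rank of the projection for `[a, b]`
at both ends, which cancels (`dimJump_eq`). Two subdivisions are compared by telescoping each piece
of one along the points of the other. Concatenation and reversal transport admissible data. For
invertible operators `0` itself is in the resolvent set, so the dimension over `[0, a]` is already a
constant rank.

Unboundedness is handled by the factorization `z - T = resFactor T z ∘ (-i - T)`: the resolvent
becomes a fixed bounded operator times the inverse of a bounded factor affine in `z`. -/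

theorem shift_apply (T : H →ₗ.[ℂ] H) (z : ℂ) (u : T.domain) :
    shift T z u = z • (u : H) - T u := rfl

theorem IsResolventAt.bijective {T : H →ₗ.[ℂ] H} {z : ℂ} {R : H →L[ℂ] H}
    (h : IsResolventAt T z R) : Function.Bijective (shift T z) := by
  refine ⟨fun u v huv => Subtype.ext ?_, fun v => ?_⟩
  · rw [← h.1 u, ← h.1 v, huv]
  · obtain ⟨u, -, hu⟩ := h.2 v
    exact ⟨u, hu⟩

theorem IsResolventAt.unique {T : H →ₗ.[ℂ] H} {z : ℂ} {R S : H →L[ℂ] H}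
    (hR : IsResolventAt T z R) (hS : IsResolventAt T z S) : R = S := by
  ext v
  obtain ⟨u, hu, rfl⟩ := hR.2 v
  rw [hS.1, hu]

theorem IsResolventAt.res_eq {T : H →ₗ.[ℂ] H} {z : ℂ} {R : H →L[ℂ] H}
    (hR : IsResolventAt T z R) : res T z = R :=
  (res_spec ⟨R, hR⟩).unique hR

theorem res_of_notMem {T : H →ₗ.[ℂ] H} {z : ℂ} (hz : z ∉ resSet T) : res T z = 0 :=
  dif_neg hz

theorem res_sub_res {T : H →ₗ.[ℂ] H} {z w : ℂ} (hz : z ∈ resSet T) (hw : w ∈ resSet T) :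
    res T z - res T w = (w - z) • (res T w * res T z) := by
  ext v
  obtain ⟨u, hu, hv⟩ := (res_spec hz).2 v
  have h := (res_spec hw).1 u
  have h2 : shift T w u = v + (w - z) • (u : H) := by
    rw [← hv, shift_apply, shift_apply, sub_smul]
    abel
  rw [h2, map_add, map_smul] at h
  change res T z v - res T w v = (w - z) • res T w (res T z v)
  rw [← hu, sub_eq_iff_eq_add', h]

theorem res_mul_res {T : H →ₗ.[ℂ] H} {z w : ℂ} (hz : z ∈ resSet T) (hw : w ∈ resSet T)
    (hzw : w ≠ z) : res T w * res T z = (w - z)⁻¹ • (res T z - res T w) := by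
  rw [res_sub_res hz hw, smul_smul, inv_mul_cancel₀ (sub_ne_zero.mpr hzw), one_smul]

theorem commute_res {T : H →ₗ.[ℂ] H} {z w : ℂ} (hz : z ∈ resSet T) (hw : w ∈ resSet T) :
    Commute (res T z) (res T w) := by
  rcases eq_or_ne w z with rfl | h
  · exact Commute.refl _
  · rw [Commute, SemiconjBy, res_mul_res hw hz h.symm, res_mul_res hz hw h, ← neg_sub w z,
      ← neg_sub (res T z) (res T w), inv_neg, neg_smul_neg]

/-- The operator `1 + (z + i) (-i - T)⁻¹ = (z - T) (-i - T)⁻¹`. -/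
def resFactor (T : H →ₗ.[ℂ] H) (z : ℂ) : H →L[ℂ] H :=
  1 + (z + I) • res T (-I)

theorem resFactor_apply (T : H →ₗ.[ℂ] H) (z : ℂ) (v : H) :
    resFactor T z v = v + (z + I) • res T (-I) v := rfl

theorem resFactor_shift {T : H →ₗ.[ℂ] H} (hT : -I ∈ resSet T) (z : ℂ) (u : T.domain) :
    resFactor T z (shift T (-I) u) = shift T z u := by
  rw [resFactor_apply, (res_spec hT).1, shift_apply, shift_apply, add_smul, neg_smul]
  abel

theorem resFactor_bijective_iff {T : H →ₗ.[ℂ] H} (hT : -I ∈ resSet T) (z : ℂ) :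
    Function.Bijective (resFactor T z) ↔ Function.Bijective (shift T z) := by
  have h : ⇑(shift T z) = resFactor T z ∘ shift T (-I) :=
    funext fun u => (resFactor_shift hT z u).symm
  rw [h, Function.Bijective.of_comp_iff _ (res_spec hT).bijective]

theorem isResolventAt_mul {T : H →ₗ.[ℂ] H} (hT : -I ∈ resSet T) {z : ℂ} {G : H →L[ℂ] H}
    (h1 : G * resFactor T z = 1) (h2 : resFactor T z * G = 1) :
    IsResolventAt T z (res T (-I) * G) := by
  refine ⟨fun u => ?_, fun v => ?_⟩
  · have := congrArg (fun L : H →L[ℂ] H => L (shift T (-I) u)) h1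
    change G (resFactor T z (shift T (-I) u)) = shift T (-I) u at this
    rw [resFactor_shift hT] at this
    change res T (-I) (G _) = _
    rw [this, (res_spec hT).1]
  · obtain ⟨u, hu, hv⟩ := (res_spec hT).2 (G v)
    refine ⟨u, hu, ?_⟩
    rw [← resFactor_shift hT, hv]
    exact congrArg (fun L : H →L[ℂ] H => L v) h2

variable [CompleteSpace H]

theorem mem_resSet_iff_isUnit {T : H →ₗ.[ℂ] H} (hT : -I ∈ resSet T) {z : ℂ} :
    z ∈ resSet T ↔ IsUnit (resFactor T z) := by
  refine ⟨fun h => ?_, fun h => ?_⟩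
  · exact ContinuousLinearMap.isUnit_iff_bijective.mpr
      ((resFactor_bijective_iff hT z).mpr (res_spec h).bijective)
  · exact ⟨_, isResolventAt_mul hT (Ring.inverse_mul_cancel _ h) (Ring.mul_inverse_cancel _ h)⟩

theorem mem_resSet_iff_bijective {T : H →ₗ.[ℂ] H} (hT : -I ∈ resSet T) {z : ℂ} :
    z ∈ resSet T ↔ Function.Bijective (shift T z) := by
  rw [mem_resSet_iff_isUnit hT, ContinuousLinearMap.isUnit_iff_bijective,
    resFactor_bijective_iff hT]

/-- Both sides default to `0` off the resolvent set, so no condition on `z` is needed. Openness,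
holomorphy and continuity come from this passage to units of the algebra of bounded operators. -/
theorem res_eq_mul_inverse {T : H →ₗ.[ℂ] H} (hT : -I ∈ resSet T) (z : ℂ) :
    res T z = res T (-I) * Ring.inverse (resFactor T z) := by
  by_cases h : IsUnit (resFactor T z)
  · exact (isResolventAt_mul hT (Ring.inverse_mul_cancel _ h) (Ring.mul_inverse_cancel _ h)).res_eq
  · rw [res_of_notMem (mt (mem_resSet_iff_isUnit hT).mp h), Ring.inverse_non_unit _ h, mul_zero]

theorem isOpen_resSet {T : H →ₗ.[ℂ] H} (hT : -I ∈ resSet T) : IsOpen (resSet T) := by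
  have h : resSet T = resFactor T ⁻¹' {x | IsUnit x} := by
    ext z
    exact mem_resSet_iff_isUnit hT
  rw [h]
  refine Units.isOpen.preimage ?_
  unfold resFactor
  fun_prop

theorem differentiableAt_res {T : H →ₗ.[ℂ] H} (hT : -I ∈ resSet T) {z : ℂ} (hz : z ∈ resSet T) :
    DifferentiableAt ℂ (res T) z := by
  rw [show res T = fun z => res T (-I) * Ring.inverse (resFactor T z) from
    funext (res_eq_mul_inverse hT)]
  refine (DifferentiableAt.inverse ?_ ((mem_resSet_iff_isUnit hT).mp hz)).const_mul _
  unfold resFactor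
  fun_prop

theorem continuousOn_res {T : H →ₗ.[ℂ] H} (hT : -I ∈ resSet T) :
    ContinuousOn (res T) (resSet T) :=
  fun _ hz => (differentiableAt_res hT hz).continuousAt.continuousWithinAt

theorem zero_mem_resSet_iff {T : H →ₗ.[ℂ] H} (hT : -I ∈ resSet T) :
    0 ∈ resSet T ↔ IsInvertible T := by
  rw [mem_resSet_iff_bijective hT, IsInvertible]
  have h : ⇑(shift T 0) = Neg.neg ∘ T.toFun := by
    funext u
    rw [shift_apply, zero_smul, zero_sub]
    rfl
  rw [h, Function.Bijective.of_comp_iff' neg_involutive.bijective]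

end Resolvent

/-! ### Non-real numbers lie in the resolvent set -/

section SelfAdjoint

variable {H : Type*} [NormedAddCommGroup H] [InnerProductSpace ℂ H] [CompleteSpace H]

theorem inner_symm_apply {T : H →ₗ.[ℂ] H} (hT : IsSelfAdjoint T) (u v : T.domain) :
    inner ℂ (T u) (v : H) = inner ℂ (u : H) (T v) := by
  have h := LinearPMap.adjoint_isFormalAdjoint hT.dense_domain
  rw [LinearPMap.isSelfAdjoint_def.mp hT] at h
  exact h u v

/-- A vector orthogonal to the range of `z - T` is an eigenvector for the conjugate of `z`. -/
theorem exists_shift_eq_zero_of_orthogonal {T : H →ₗ.[ℂ] H} (hT : IsSelfAdjoint T) {z : ℂ} {w : H}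
    (hw : ∀ u : T.domain, inner ℂ w (shift T z u) = 0) :
    ∃ u : T.domain, (u : H) = w ∧ shift T (starRingEnd ℂ z) u = 0 := by
  have horth : ∀ u : T.domain, inner ℂ (starRingEnd ℂ z • w) (u : H) = inner ℂ w (T u) := by
    intro u
    have h0 := hw u
    rw [shift_apply, inner_sub_right, inner_smul_right] at h0
    rw [inner_smul_left, Complex.conj_conj]
    exact sub_eq_zero.mp h0
  have hmem : w ∈ (LinearPMap.adjoint T).domain :=
    LinearPMap.mem_adjoint_domain_of_exists w ⟨_, horth⟩
  have hval := LinearPMap.adjoint_apply_eq hT.dense_domain ⟨w, hmem⟩ horth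
  have hg : (w, starRingEnd ℂ z • w) ∈ (LinearPMap.adjoint T).graph := by
    rw [← hval]
    exact LinearPMap.mem_graph _ (⟨w, hmem⟩ : (LinearPMap.adjoint T).domain)
  rw [LinearPMap.isSelfAdjoint_def.mp hT] at hg
  obtain ⟨w', hw1, hw2⟩ := LinearPMap.mem_graph_iff T |>.mp hg
  refine ⟨w', hw1, ?_⟩
  rw [shift_apply, hw1, hw2, sub_self]

/-- By symmetry `⟨u, T u⟩` is real, so `⟨u, (z - T) u⟩` has imaginary part `z.im * ‖u‖ ^ 2`;
Cauchy–Schwarz does the rest. -/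
theorem abs_im_mul_norm_le {T : H →ₗ.[ℂ] H} (hT : IsSelfAdjoint T) (z : ℂ) (u : T.domain) :
    |z.im| * ‖(u : H)‖ ≤ ‖shift T z u‖ := by
  rcases eq_or_ne ‖(u : H)‖ 0 with h0 | h0
  · rw [h0, mul_zero]
    exact norm_nonneg _
  have hreal : (inner ℂ (u : H) (T u)).im = 0 := by
    have hsym := inner_symm_apply hT u u
    rw [← inner_conj_symm] at hsym
    have := congrArg Complex.im hsym
    simp only [Complex.conj_im] at this
    linarith
  have him : (inner ℂ (u : H) (shift T z u)).im = z.im * ‖(u : H)‖ ^ 2 := by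
    have hsq : inner ℂ (u : H) (u : H) = ((‖(u : H)‖ ^ 2 : ℝ) : ℂ) := by
      rw [inner_self_eq_norm_sq_to_K]
      norm_cast
    rw [shift_apply, inner_sub_right, inner_smul_right, hsq, Complex.sub_im, hreal, sub_zero,
      Complex.im_mul_ofReal]
  have h1 : |z.im| * ‖(u : H)‖ ^ 2 ≤ ‖(u : H)‖ * ‖shift T z u‖ := by
    rw [← abs_of_nonneg (sq_nonneg ‖(u : H)‖), ← abs_mul, ← him]
    exact (Complex.abs_im_le_norm _).trans (norm_inner_le_norm _ _)
  have h2 : 0 < ‖(u : H)‖ := lt_of_le_of_ne (norm_nonneg _) (Ne.symm h0)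
  nlinarith

/-- The bounded factor is bounded below, hence injective with closed range. A vector orthogonal to
the range is an eigenvector for the conjugate of `z`, which is again non-real, so it vanishes. -/
theorem mem_resSet_of_im_ne_zero {T : H →ₗ.[ℂ] H} (hT : IsSelfAdjoint T) {z : ℂ}
    (hz : z.im ≠ 0) : z ∈ resSet T := by
  have hI : -I ∈ resSet T := neg_I_mem_resSet hT
  rw [mem_resSet_iff_isUnit hI, ContinuousLinearMap.isUnit_iff_bijective]
  have hbound : ∀ v : H, ‖v‖ ≤ (1 + ‖z + I‖ / |z.im|) * ‖resFactor T z v‖ := by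
    intro v
    obtain ⟨u, hu, hv⟩ := (res_spec hI).2 v
    have h1 := abs_im_mul_norm_le hT z u
    rw [← resFactor_shift hI, hv] at h1
    have h2 : v = resFactor T z v - (z + I) • (u : H) := by
      rw [resFactor_apply, ← hu, add_sub_cancel_right]
    have h3 : ‖v‖ ≤ ‖resFactor T z v‖ + ‖z + I‖ * ‖(u : H)‖ := by
      conv_lhs => rw [h2]
      exact (norm_sub_le _ _).trans_eq (by rw [norm_smul])
    have h4 : ‖(u : H)‖ ≤ ‖resFactor T z v‖ / |z.im| := by
      rw [le_div_iff₀' (abs_pos.mpr hz)]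
      exact h1
    refine h3.trans ((add_le_add_right
      (mul_le_mul_of_nonneg_left h4 (norm_nonneg _)) _).trans_eq ?_)
    ring
  have hanti : AntilipschitzWith (Real.toNNReal (1 + ‖z + I‖ / |z.im|)) (resFactor T z) := by
    refine AddMonoidHomClass.antilipschitz_of_bound _ fun v => ?_
    rw [Real.coe_toNNReal _ (by positivity)]
    exact hbound v
  refine ⟨hanti.injective, ?_⟩
  have hcl : IsClosed ((LinearMap.range (resFactor T z).toLinearMap : Submodule ℂ H) : Set H) := by
    rw [LinearMap.coe_range]
    exact hanti.isClosed_range (resFactor T z).uniformContinuous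
  have : CompleteSpace (LinearMap.range (resFactor T z).toLinearMap) := hcl.completeSpace_coe
  have htop : LinearMap.range (resFactor T z).toLinearMap = ⊤ := by
    rw [← Submodule.orthogonal_eq_bot_iff, Submodule.eq_bot_iff]
    intro w hw
    obtain ⟨u, rfl, hu⟩ := exists_shift_eq_zero_of_orthogonal hT (z := z) (w := w) fun u => by
      rw [← resFactor_shift hI]
      exact Submodule.inner_left_of_mem_orthogonal (LinearMap.mem_range_self _ _) hw
    have h := abs_im_mul_norm_le hT (starRingEnd ℂ z) u
    rw [hu, norm_zero, Complex.conj_im, abs_neg] at h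
    exact norm_le_zero_iff.mp (nonpos_of_mul_nonpos_right h (abs_pos.mpr hz))
  exact LinearMap.range_eq_top.mp htop

end SelfAdjoint

end SpecFlow

end

noncomputable section

namespace SpecFlow

open scoped Topology

open Complex Metric Set Filter

/-! ### Circle integrals: bounded maps, Fubini, Cauchy -/

section CircleIntegral

variable {E F : Type*} [NormedAddCommGroup E] [NormedSpace ℂ E] [NormedAddCommGroup F]
  [NormedSpace ℂ F]

theorem clm_circleIntegral [CompleteSpace E] [CompleteSpace F] (L : E →L[ℂ] F) {f : ℂ → E} {c : ℂ}
    {r : ℝ} (hf : CircleIntegrable f c r) : L (∮ z in C(c, r), f z) = ∮ z in C(c, r), L (f z) := by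
  rw [circleIntegral, circleIntegral, ← L.intervalIntegral_comp_comm hf.out]
  simp only [map_smul]

theorem circleIntegral_swap [CompleteSpace E] {f : ℂ → ℂ → E} {c c' : ℂ} {r r' : ℝ} (hr : 0 ≤ r)
    (hr' : 0 ≤ r') (hf : ContinuousOn (Function.uncurry f) (sphere c r ×ˢ sphere c' r')) :
    (∮ z in C(c, r), ∮ w in C(c', r'), f z w) = ∮ w in C(c', r'), ∮ z in C(c, r), f z w := by
  have hcont : Continuous (Function.uncurry fun s t : ℝ =>
      deriv (circleMap c r) s • deriv (circleMap c' r') t •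
        f (circleMap c r s) (circleMap c' r' t)) := by
    have h1 : Continuous fun p : ℝ × ℝ => f (circleMap c r p.1) (circleMap c' r' p.2) :=
      hf.comp_continuous (f := fun p : ℝ × ℝ => (circleMap c r p.1, circleMap c' r' p.2))
        (by fun_prop)
        fun p => ⟨circleMap_mem_sphere c hr _, circleMap_mem_sphere c' hr' _⟩
    have h2 : Continuous fun p : ℝ × ℝ => deriv (circleMap c r) p.1 := by
      simp only [deriv_circleMap]
      fun_prop
    have h3 : Continuous fun p : ℝ × ℝ => deriv (circleMap c' r') p.2 := by
      simp only [deriv_circleMap]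
      fun_prop
    exact h2.smul (h3.smul h1)
  simp only [circleIntegral, ← intervalIntegral.integral_smul]
  rw [MeasureTheory.intervalIntegral_intervalIntegral_swap]
  · simp only [smul_comm (deriv (circleMap c r) _)]
  · exact (hcont.continuousOn.integrableOn_compact (isCompact_uIcc.prod isCompact_uIcc)).mono_set
      (prod_mono uIoc_subset_uIcc uIoc_subset_uIcc)

theorem circleIntegral_sub_inv_eq_zero {c w : ℂ} {r : ℝ} (hr : 0 ≤ r) (hw : w ∉ closedBall c r) :
    (∮ z in C(c, r), (z - w)⁻¹) = 0 := by
  have hne : ∀ z ∈ closedBall c r, z - w ≠ 0 := fun z hz h => hw (by rwa [← sub_eq_zero.mp h])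
  have hd : ∀ z ∈ closedBall c r, DifferentiableAt ℂ (fun z => (z - w)⁻¹) z := fun z hz =>
    (differentiableAt_id.sub_const w).inv (hne z hz)
  exact circleIntegral_eq_zero_of_differentiable_on_off_countable hr countable_empty
    (fun z hz => (hd z hz).continuousAt.continuousWithinAt)
    fun z hz => hd z (ball_subset_closedBall hz.1)

end CircleIntegral

/-! ### Riesz integrals of the resolvent -/

section CircleProj

variable {H : Type*} [NormedAddCommGroup H] [InnerProductSpace ℂ H]

/-- The Riesz integral `(2πi)⁻¹ ∮ (z - T)⁻¹ dz` over the circle of radius `r` around `c`. -/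
def circleProj (T : H →ₗ.[ℂ] H) (c : ℂ) (r : ℝ) : H →L[ℂ] H :=
  (2 * Real.pi * Complex.I : ℂ)⁻¹ • circleIntegral (fun z => res T z) c r

theorem spectralProj_eq_circleProj (T : H →ₗ.[ℂ] H) (a b : ℝ) :
    spectralProj T a b = circleProj T (((a + b) / 2 : ℝ) : ℂ) ((b - a) / 2) := rfl

theorem res_apply_of_shift_eq_zero {T : H →ₗ.[ℂ] H} {z μ : ℂ} (hz : z ∈ resSet T) {u : T.domain}
    (hu : shift T μ u = 0) : res T z u = (z - μ)⁻¹ • (u : H) := by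
  have h := (res_spec hz).1 u
  have hs : shift T z u = (z - μ) • (u : H) := by
    rw [shift_apply, sub_eq_zero] at hu
    rw [shift_apply, ← hu, sub_smul]
  rw [hs, map_smul] at h
  rcases eq_or_ne z μ with rfl | hne
  · rw [sub_self, zero_smul] at h
    rw [← h, map_zero, smul_zero]
  · rw [eq_inv_smul_iff₀ (sub_ne_zero.mpr hne), h]

theorem circleIntegrable_res [CompleteSpace H] {T : H →ₗ.[ℂ] H} (hT : -I ∈ resSet T) {c : ℂ} {r : ℝ}
    (hr : 0 ≤ r) (h : sphere c r ⊆ resSet T) : CircleIntegrable (fun z => res T z) c r :=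
  ((continuousOn_res hT).mono h).circleIntegrable hr

/-- Stated for a general `L` in order to cover evaluation at a vector, multiplication on either
side, and matrix coefficients. -/
theorem clm_circleProj [CompleteSpace H] {E : Type*} [NormedAddCommGroup E] [NormedSpace ℂ E]
    [CompleteSpace E] {T : H →ₗ.[ℂ] H} (hT : -I ∈ resSet T) {c : ℂ} {r : ℝ}
    (hr : 0 ≤ r) (h : sphere c r ⊆ resSet T) (L : (H →L[ℂ] H) →L[ℂ] E) :
    L (circleProj T c r) = (2 * Real.pi * I : ℂ)⁻¹ • ∮ z in C(c, r), L (res T z) := by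
  rw [circleProj, map_smul, clm_circleIntegral L (circleIntegrable_res hT hr h)]

theorem circleProj_apply [CompleteSpace H] {T : H →ₗ.[ℂ] H} (hT : -I ∈ resSet T) {c : ℂ} {r : ℝ}
    (hr : 0 ≤ r) (h : sphere c r ⊆ resSet T) (v : H) :
    circleProj T c r v = (2 * Real.pi * I : ℂ)⁻¹ • ∮ z in C(c, r), res T z v :=
  clm_circleProj hT hr h (ContinuousLinearMap.apply ℂ H v)

theorem circleProj_apply_of_mem [CompleteSpace H] {T : H →ₗ.[ℂ] H} (hT : -I ∈ resSet T) {c : ℂ}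
    {r : ℝ} (hr : 0 ≤ r) (h : sphere c r ⊆ resSet T) {μ : ℂ} (hμ : μ ∈ ball c r) {u : T.domain}
    (hu : shift T μ u = 0) : circleProj T c r u = u := by
  rw [circleProj_apply hT hr h, circleIntegral.integral_congr hr (g := fun z => (z - μ)⁻¹ • (u : H))
    fun z hz => res_apply_of_shift_eq_zero (h hz) hu, circleIntegral.integral_smul_const,
    circleIntegral.integral_sub_inv_of_mem_ball hμ, inv_smul_smul₀ two_pi_I_ne_zero]

theorem circleProj_apply_of_notMem [CompleteSpace H] {T : H →ₗ.[ℂ] H} (hT : -I ∈ resSet T) {c : ℂ}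
    {r : ℝ} (hr : 0 ≤ r) (h : sphere c r ⊆ resSet T) {μ : ℂ} (hμ : μ ∉ closedBall c r)
    {u : T.domain} (hu : shift T μ u = 0) : circleProj T c r u = 0 := by
  rw [circleProj_apply hT hr h, circleIntegral.integral_congr hr (g := fun z => (z - μ)⁻¹ • (u : H))
    fun z hz => res_apply_of_shift_eq_zero (h hz) hu, circleIntegral.integral_smul_const,
    circleIntegral_sub_inv_eq_zero hr hμ, zero_smul, smul_zero]

/-- The resolvent identity splits the product in two; the part with the constant factor `res T w`
integrates to zero, since `w` lies outside the circle. -/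
theorem res_mul_circleIntegral [CompleteSpace H] {T : H →ₗ.[ℂ] H} (hT : -I ∈ resSet T) {c : ℂ}
    {r : ℝ} (hr : 0 ≤ r) (h : sphere c r ⊆ resSet T) {w : ℂ} (hw : w ∈ resSet T)
    (hwc : w ∉ closedBall c r) :
    res T w * (∮ z in C(c, r), res T z) = ∮ z in C(c, r), (w - z)⁻¹ • res T z := by
  have hne : ∀ z ∈ sphere c r, w ≠ z := fun z hz e => hwc (by
    rw [e]
    exact sphere_subset_closedBall hz)
  have hcont : ContinuousOn (fun z => (w - z)⁻¹) (sphere c r) :=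
    (continuousOn_const.sub continuousOn_id).inv₀ fun z hz => sub_ne_zero.mpr (hne z hz)
  have h0 : (∮ z in C(c, r), (w - z)⁻¹) = 0 := by
    have h1 : (fun z => (w - z)⁻¹) = fun z => (-1 : ℂ) • (z - w)⁻¹ := by
      funext z
      rw [← neg_sub, inv_neg, neg_one_smul]
    rw [h1, circleIntegral.integral_smul, circleIntegral_sub_inv_eq_zero hr hwc, smul_zero]
  calc res T w * (∮ z in C(c, r), res T z)
      = ∮ z in C(c, r), res T w * res T z :=
        clm_circleIntegral (ContinuousLinearMap.mul ℂ (H →L[ℂ] H) (res T w))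
          (circleIntegrable_res hT hr h)
    _ = ∮ z in C(c, r), ((w - z)⁻¹ • res T z - (w - z)⁻¹ • res T w) :=
        circleIntegral.integral_congr hr fun z hz => by
          simp only [res_mul_res (h hz) hw (hne z hz), smul_sub]
    _ = (∮ z in C(c, r), (w - z)⁻¹ • res T z) - ∮ z in C(c, r), (w - z)⁻¹ • res T w :=
        circleIntegral.integral_sub
          ((hcont.smul ((continuousOn_res hT).mono h)).circleIntegrable hr)
          ((hcont.smul continuousOn_const).circleIntegrable hr)
    _ = ∮ z in C(c, r), (w - z)⁻¹ • res T z := by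
        rw [circleIntegral.integral_smul_const, h0, zero_smul, sub_zero]

/-- The classical Riesz computation: after the resolvent identity and an exchange of integrals, the
outer circle integral of `(w - z)⁻¹` is `2πi`. The circles must be disjoint to keep the kernel
continuous. -/
theorem circleProj_mul_circleProj [CompleteSpace H] {T : H →ₗ.[ℂ] H} (hT : -I ∈ resSet T)
    {c c' : ℂ} {r r' : ℝ} (hr : 0 ≤ r) (hr' : 0 ≤ r') (h : sphere c r ⊆ resSet T)
    (h' : sphere c' r' ⊆ resSet T) (hsub : closedBall c r ⊆ ball c' r') :
    circleProj T c' r' * circleProj T c r = circleProj T c r := by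
  have hw : ∀ w ∈ sphere c' r', w ∉ closedBall c r := fun w hw hwc =>
    sphere_disjoint_ball.le_bot ⟨hw, hsub hwc⟩
  have hne : ∀ w ∈ sphere c' r', ∀ z ∈ sphere c r, w - z ≠ 0 := fun w hw' z hz e =>
    hw w hw' (by
      rw [sub_eq_zero.mp e]
      exact sphere_subset_closedBall hz)
  have key : (∮ w in C(c', r'), res T w) * (∮ z in C(c, r), res T z) =
      (2 * Real.pi * I : ℂ) • ∮ z in C(c, r), res T z := by
    calc (∮ w in C(c', r'), res T w) * (∮ z in C(c, r), res T z)
        = ∮ w in C(c', r'), res T w * (∮ z in C(c, r), res T z) :=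
          clm_circleIntegral ((ContinuousLinearMap.mul ℂ (H →L[ℂ] H)).flip
            (∮ z in C(c, r), res T z)) (circleIntegrable_res hT hr' h')
      _ = ∮ w in C(c', r'), ∮ z in C(c, r), (w - z)⁻¹ • res T z :=
          circleIntegral.integral_congr hr' fun w hw' =>
            res_mul_circleIntegral hT hr h (h' hw') (hw w hw')
      _ = ∮ z in C(c, r), ∮ w in C(c', r'), (w - z)⁻¹ • res T z := by
          refine circleIntegral_swap (f := fun w z => (w - z)⁻¹ • res T z) hr' hr ?_
          have h1 : ContinuousOn (fun p : ℂ × ℂ => (p.1 - p.2)⁻¹) (sphere c' r' ×ˢ sphere c r) :=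
            (continuousOn_fst.sub continuousOn_snd).inv₀ fun p hp => hne _ hp.1 _ hp.2
          have h2 : ContinuousOn (fun p : ℂ × ℂ => res T p.2) (sphere c' r' ×ˢ sphere c r) :=
            (continuousOn_res hT).comp continuousOn_snd fun p hp => h hp.2
          exact h1.smul h2
      _ = ∮ z in C(c, r), (2 * Real.pi * I : ℂ) • res T z :=
          circleIntegral.integral_congr hr fun z hz => by
            simp only [circleIntegral.integral_smul_const,
              circleIntegral.integral_sub_inv_of_mem_ball (hsub (sphere_subset_closedBall hz))]
      _ = _ := circleIntegral.integral_smul _ _ _ _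
  rw [circleProj, circleProj, smul_mul_smul_comm, key, smul_smul, mul_assoc,
    inv_mul_cancel₀ two_pi_I_ne_zero, mul_one]

theorem circleProj_eq_of_annulus [CompleteSpace H] {T : H →ₗ.[ℂ] H} (hT : -I ∈ resSet T) {c : ℂ}
    {r r' : ℝ} (hr : 0 < r) (hrr' : r ≤ r') (h : closedBall c r' \ ball c r ⊆ resSet T) :
    circleProj T c r' = circleProj T c r := by
  rw [circleProj, circleProj, circleIntegral_eq_of_differentiable_on_annulus_off_countable hr hrr'
    countable_empty ((continuousOn_res hT).mono h) fun z hz => differentiableAt_res hT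
      (h ⟨ball_subset_closedBall hz.1.1, fun hz' => hz.1.2 (ball_subset_closedBall hz')⟩)]

end CircleProj

/-! ### Spectral projections of intervals with endpoints in the resolvent set -/

section SpectralProj

variable {H : Type*} [NormedAddCommGroup H] [InnerProductSpace ℂ H] [CompleteSpace H]

/-- The circle can meet the real axis only at `a` and `b`. -/
theorem sphere_subset_resSet {T : H →ₗ.[ℂ] H} (hT : IsSelfAdjoint T) {a b : ℝ}
    (ha : (a : ℂ) ∈ resSet T) (hb : (b : ℂ) ∈ resSet T) :
    sphere (((a + b) / 2 : ℝ) : ℂ) ((b - a) / 2) ⊆ resSet T := by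
  intro z hz
  by_cases him : z.im = 0
  · obtain ⟨x, rfl⟩ : ∃ x : ℝ, (x : ℂ) = z := ⟨z.re, Complex.ext rfl him.symm⟩
    rw [mem_sphere, Complex.dist_eq, ← Complex.ofReal_sub, Complex.norm_real, Real.norm_eq_abs] at hz
    rcases abs_choice (x - (a + b) / 2) with h | h
    · rwa [show x = b by linarith]
    · rwa [show x = a by linarith]
  · exact mem_resSet_of_im_ne_zero hT him

theorem exists_annulus_subset_resSet {T : H →ₗ.[ℂ] H} (hT : IsSelfAdjoint T) {a b : ℝ}
    (ha : (a : ℂ) ∈ resSet T) (hb : (b : ℂ) ∈ resSet T) :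
    ∃ ε > 0, closedBall (((a + b) / 2 : ℝ) : ℂ) ((b - a) / 2 + ε) \
      ball (((a + b) / 2 : ℝ) : ℂ) ((b - a) / 2) ⊆ resSet T := by
  have hopen := isOpen_resSet (neg_I_mem_resSet hT)
  obtain ⟨δ, hδ, hδa⟩ := Metric.isOpen_iff.mp hopen _ ha
  obtain ⟨η, hη, hηb⟩ := Metric.isOpen_iff.mp hopen _ hb
  refine ⟨min δ η / 2, by positivity, fun z hz => ?_⟩
  have hle1 := min_le_left δ η
  have hle2 := min_le_right δ η
  have hpos : 0 < min δ η := by positivity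
  by_cases him : z.im = 0
  · obtain ⟨x, rfl⟩ : ∃ x : ℝ, (x : ℂ) = z := ⟨z.re, Complex.ext rfl him.symm⟩
    obtain ⟨h1, h2⟩ := hz
    rw [mem_closedBall, Complex.dist_eq, ← Complex.ofReal_sub, Complex.norm_real,
      Real.norm_eq_abs] at h1
    rw [mem_ball, Complex.dist_eq, ← Complex.ofReal_sub, Complex.norm_real,
      Real.norm_eq_abs, not_lt] at h2
    rcases abs_choice (x - (a + b) / 2) with h | h
    · refine hηb ?_
      rw [mem_ball, Complex.dist_eq, ← Complex.ofReal_sub, Complex.norm_real, Real.norm_eq_abs,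
        abs_lt]
      constructor <;> linarith
    · refine hδa ?_
      rw [mem_ball, Complex.dist_eq, ← Complex.ofReal_sub, Complex.norm_real, Real.norm_eq_abs,
        abs_lt]
      constructor <;> linarith
  · exact mem_resSet_of_im_ne_zero hT him

theorem spectralProj_mul_of_le {T : H →ₗ.[ℂ] H} (hT : IsSelfAdjoint T) {a b a' b' : ℝ}
    (ha : (a : ℂ) ∈ resSet T) (hb : (b : ℂ) ∈ resSet T) (ha' : (a' : ℂ) ∈ resSet T)
    (hb' : (b' : ℂ) ∈ resSet T) (hab : a < b) (haa' : a' ≤ a) (hbb' : b ≤ b') :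
    spectralProj T a' b' * spectralProj T a b = spectralProj T a b := by
  obtain ⟨ε, hε, hsub⟩ := exists_annulus_subset_resSet hT ha' hb'
  have hI := neg_I_mem_resSet hT
  rw [spectralProj_eq_circleProj, spectralProj_eq_circleProj,
    -- Enlarging the outer circle slightly separates the two circles even when the intervals share
    -- endpoints or coincide; the latter case gives idempotence.
    ← circleProj_eq_of_annulus hI (by linarith) (by linarith) hsub]
  refine circleProj_mul_circleProj hI (by linarith) (by linarith) (sphere_subset_resSet hT ha hb)
    (fun z hz => hsub ⟨sphere_subset_closedBall hz, fun hz' => ?_⟩) (closedBall_subset_ball' ?_)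
  · rw [mem_sphere] at hz
    rw [mem_ball] at hz'
    linarith
  · rw [Complex.dist_eq, ← Complex.ofReal_sub, Complex.norm_real, Real.norm_eq_abs]
    have : |(a + b) / 2 - (a' + b') / 2| ≤ (b' - a') / 2 - (b - a) / 2 := by
      rw [abs_le]
      constructor <;> linarith
    linarith

theorem isIdempotentElem_spectralProj {T : H →ₗ.[ℂ] H} (hT : IsSelfAdjoint T) {a b : ℝ}
    (ha : (a : ℂ) ∈ resSet T) (hb : (b : ℂ) ∈ resSet T) (hab : a < b) :
    IsIdempotentElem (spectralProj T a b) :=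
  spectralProj_mul_of_le hT ha hb ha hb hab le_rfl le_rfl

theorem commute_res_spectralProj {T : H →ₗ.[ℂ] H} (hT : IsSelfAdjoint T) {a b : ℝ}
    (ha : (a : ℂ) ∈ resSet T) (hb : (b : ℂ) ∈ resSet T) (hab : a < b) {w : ℂ} (hw : w ∈ resSet T) :
    Commute (res T w) (spectralProj T a b) := by
  have hI := neg_I_mem_resSet hT
  have hr : 0 ≤ (b - a) / 2 := by linarith
  have hs := sphere_subset_resSet hT ha hb
  have h1 := clm_circleProj hI hr hs (ContinuousLinearMap.mul ℂ (H →L[ℂ] H) (res T w))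
  have h2 := clm_circleProj hI hr hs ((ContinuousLinearMap.mul ℂ (H →L[ℂ] H)).flip (res T w))
  rw [Commute, SemiconjBy, spectralProj_eq_circleProj]
  refine h1.trans (Eq.trans ?_ h2.symm)
  congr 1
  exact circleIntegral.integral_congr hr fun z hz => (commute_res (hs hz) hw).symm

end SpectralProj

/-! ### Gap continuity of resolvents and spectral projections -/

section Continuity

variable {H : Type*} [NormedAddCommGroup H] [InnerProductSpace ℂ H] [CompleteSpace H]

/-- The Cayley transform is `1 + 2i` times this resolvent, and the gap metric makes it an isometry.
-/
theorem continuous_res_neg_I : Continuous fun T : CFsa H => res T.op (-I) := by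
  have hc : Continuous fun T : CFsa H => cayley T.op :=
    (isometry_iff_dist_eq.mpr fun _ _ => rfl : Isometry fun T : CFsa H => cayley T.op).continuous
  have h : (fun T : CFsa H => res T.op (-I)) =
      fun T : CFsa H => (2 * I)⁻¹ • (cayley T.op - ContinuousLinearMap.id ℂ H) := by
    funext T
    rw [cayley, smul_neg, sub_neg_eq_add, add_sub_cancel_left, inv_smul_smul₀ (by simp)]
  rw [h]
  exact (hc.sub continuous_const).const_smul ((2 * I)⁻¹ : ℂ)

theorem continuous_resFactor : Continuous fun p : CFsa H × ℂ => resFactor p.1.op p.2 := by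
  unfold resFactor
  exact continuous_const.add ((continuous_snd.add continuous_const).smul
    (continuous_res_neg_I.comp continuous_fst))

theorem isOpen_setOf_mem_resSet (z : ℂ) : IsOpen {T : CFsa H | z ∈ resSet T.op} := by
  have h : {T : CFsa H | z ∈ resSet T.op} =
      (fun T : CFsa H => resFactor T.op z) ⁻¹' {x | IsUnit x} := by
    ext T
    exact mem_resSet_iff_isUnit (neg_I_mem_resSet T.selfAdjoint)
  rw [h]
  exact Units.isOpen.preimage
    (continuous_resFactor.comp (continuous_id.prodMk continuous_const))

theorem continuousOn_res_prod :
    ContinuousOn (fun p : CFsa H × ℂ => res p.1.op p.2) {p | p.2 ∈ resSet p.1.op} := by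
  have h : (fun p : CFsa H × ℂ => res p.1.op p.2) =
      fun p => res p.1.op (-I) * Ring.inverse (resFactor p.1.op p.2) :=
    funext fun p => res_eq_mul_inverse (neg_I_mem_resSet p.1.selfAdjoint) _
  rw [h]
  refine (continuous_res_neg_I.comp continuous_fst).continuousOn.mul fun p hp => ?_
  obtain ⟨u, hu⟩ := (mem_resSet_iff_isUnit (neg_I_mem_resSet p.1.selfAdjoint)).mp hp
  have h1 := NormedRing.inverse_continuousAt u
  rw [hu] at h1
  exact (ContinuousAt.comp (f := fun p : CFsa H × ℂ => resFactor p.1.op p.2) h1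
    continuous_resFactor.continuousAt).continuousWithinAt

theorem continuousOn_spectralProj {a b : ℝ} (hab : a ≤ b) :
    ContinuousOn (fun T : CFsa H => spectralProj T.op a b)
      {T | (a : ℂ) ∈ resSet T.op ∧ (b : ℂ) ∈ resSet T.op} := by
  rw [continuousOn_iff_continuous_domRestrict]
  let S := {T : CFsa H | (a : ℂ) ∈ resSet T.op ∧ (b : ℂ) ∈ resSet T.op}
  let γ := circleMap (((a + b) / 2 : ℝ) : ℂ) ((b - a) / 2)
  have h1 : Continuous fun p : S × ℝ => deriv γ p.2 := by
    simp only [γ, deriv_circleMap]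
    fun_prop
  have h2 : Continuous fun p : S × ℝ => res p.1.1.op (γ p.2) :=
    continuousOn_res_prod.comp_continuous (f := fun p : S × ℝ => (p.1.1, γ p.2))
      ((continuous_subtype_val.comp continuous_fst).prodMk
        ((continuous_circleMap _ _).comp continuous_snd))
      fun p => sphere_subset_resSet p.1.1.selfAdjoint p.1.2.1 p.1.2.2
        (circleMap_mem_sphere _ (by linarith) _)
  have h3 : Continuous fun T : S => ∫ θ in (0)..2 * Real.pi, deriv γ θ • res T.1.op (γ θ) :=
    intervalIntegral.continuous_parametric_intervalIntegral_of_continuous'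
      (f := fun (T : S) (θ : ℝ) => deriv γ θ • res T.1.op (γ θ)) (h1.smul h2) 0 (2 * Real.pi)
  exact h3.const_smul ((2 * Real.pi * I : ℂ)⁻¹)

end Continuity

end SpecFlow

end

noncomputable section

namespace SpecFlow

open scoped Topology

open Complex Metric Set Filter

/-! ### Sums of eigenspaces as ranges of spectral projections -/

section Eigensum

theorem ofReal_mem_ball_iff {a b μ : ℝ} :
    (μ : ℂ) ∈ ball (((a + b) / 2 : ℝ) : ℂ) ((b - a) / 2) ↔ μ ∈ Ioo a b := by
  rw [mem_ball, Complex.dist_eq, ← Complex.ofReal_sub, Complex.norm_real, Real.norm_eq_abs, abs_lt,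
    mem_Ioo]
  constructor <;> rintro ⟨h1, h2⟩ <;> constructor <;> linarith

theorem ofReal_mem_closedBall_iff {a b μ : ℝ} :
    (μ : ℂ) ∈ closedBall (((a + b) / 2 : ℝ) : ℂ) ((b - a) / 2) ↔ μ ∈ Icc a b := by
  rw [mem_closedBall, Complex.dist_eq, ← Complex.ofReal_sub, Complex.norm_real, Real.norm_eq_abs,
    abs_le, mem_Icc]
  constructor <;> rintro ⟨h1, h2⟩ <;> constructor <;> linarith

variable {H : Type*} [NormedAddCommGroup H] [InnerProductSpace ℂ H]

theorem mem_eigenspace_iff {T : H →ₗ.[ℂ] H} {z : ℂ} {v : H} :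
    v ∈ eigenspace T z ↔ ∃ u : T.domain, shift T z u = 0 ∧ (u : H) = v := by
  simp [eigenspace, Submodule.mem_map]

theorem eigenspace_eq_bot {T : H →ₗ.[ℂ] H} {z : ℂ} (hz : z ∈ resSet T) : eigenspace T z = ⊥ := by
  rw [Submodule.eq_bot_iff]
  intro v hv
  obtain ⟨u, hu, rfl⟩ := mem_eigenspace_iff.mp hv
  rw [← (res_spec hz).1 u, hu, map_zero]

theorem eigensum_mono {T : H →ₗ.[ℂ] H} {a b c d : ℝ} (h : Icc a b ⊆ Icc c d) :
    eigensum T a b ≤ eigensum T c d :=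
  biSup_mono h

theorem eigensum_sup_eigensum (T : H →ₗ.[ℂ] H) {a b c : ℝ} (hab : a ≤ b) (hbc : b ≤ c) :
    eigensum T a b ⊔ eigensum T b c = eigensum T a c := by
  rw [eigensum, eigensum, eigensum, ← Icc_union_Icc_eq_Icc hab hbc, iSup_union]

variable [CompleteSpace H]

theorem spectralProj_apply_of_mem_eigensum {T : H →ₗ.[ℂ] H} (hT : IsSelfAdjoint T) {a b : ℝ}
    (ha : (a : ℂ) ∈ resSet T) (hb : (b : ℂ) ∈ resSet T) (hab : a < b) {v : H}
    (hv : v ∈ eigensum T a b) : spectralProj T a b v = v := by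
  have hle : eigensum T a b ≤
      LinearMap.eqLocus (spectralProj T a b).toLinearMap (LinearMap.id : H →ₗ[ℂ] H) := by
    refine iSup₂_le fun μ hμ => ?_
    rcases eq_or_ne μ a with rfl | hμa
    · rw [eigenspace_eq_bot ha]
      exact bot_le
    rcases eq_or_ne μ b with rfl | hμb
    · rw [eigenspace_eq_bot hb]
      exact bot_le
    intro w hw
    obtain ⟨u, hu, rfl⟩ := mem_eigenspace_iff.mp hw
    exact circleProj_apply_of_mem (neg_I_mem_resSet hT) (by linarith)
      (sphere_subset_resSet hT ha hb)
      (ofReal_mem_ball_iff.mpr ⟨lt_of_le_of_ne hμ.1 hμa.symm, lt_of_le_of_ne hμ.2 hμb⟩) hu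
  exact hle hv

theorem eigensum_le_range_spectralProj {T : H →ₗ.[ℂ] H} (hT : IsSelfAdjoint T) {a b : ℝ}
    (ha : (a : ℂ) ∈ resSet T) (hb : (b : ℂ) ∈ resSet T) (hab : a < b) :
    eigensum T a b ≤ LinearMap.range (spectralProj T a b).toLinearMap :=
  fun v hv => ⟨v, spectralProj_apply_of_mem_eigensum hT ha hb hab hv⟩

theorem spectralProj_apply_eq_zero_of_mem_eigensum {T : H →ₗ.[ℂ] H} (hT : IsSelfAdjoint T)
    {a b c : ℝ} (hb : (b : ℂ) ∈ resSet T) (hc : (c : ℂ) ∈ resSet T) (hbc : b < c) {v : H}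
    (hv : v ∈ eigensum T a b) : spectralProj T b c v = 0 := by
  have hle : eigensum T a b ≤ LinearMap.ker (spectralProj T b c).toLinearMap := by
    refine iSup₂_le fun μ hμ => ?_
    rcases eq_or_ne μ b with rfl | hμb
    · rw [eigenspace_eq_bot hb]
      exact bot_le
    intro w hw
    obtain ⟨u, hu, rfl⟩ := mem_eigenspace_iff.mp hw
    exact circleProj_apply_of_notMem (neg_I_mem_resSet hT) (by linarith)
      (sphere_subset_resSet hT hb hc)
      (fun h => hμb (le_antisymm hμ.2 (ofReal_mem_closedBall_iff.mp h).1)) hu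
  exact hle hv

/-- The projection for `[b, c]` fixes one space and kills the other; the common point `b` carries no
eigenvector. -/
theorem disjoint_eigensum {T : H →ₗ.[ℂ] H} (hT : IsSelfAdjoint T)
    {a b c : ℝ} (hb : (b : ℂ) ∈ resSet T) (hc : (c : ℂ) ∈ resSet T) (hbc : b < c) :
    Disjoint (eigensum T a b) (eigensum T b c) := by
  rw [Submodule.disjoint_def]
  intro v h1 h2
  rw [← spectralProj_apply_of_mem_eigensum hT hb hc hbc h2,
    spectralProj_apply_eq_zero_of_mem_eigensum hT hb hc hbc h1]

theorem inner_res_of_shift_eq_zero {T : H →ₗ.[ℂ] H} (hT : IsSelfAdjoint T) {z : ℂ} {μ : ℝ}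
    (hz : z ∈ resSet T) {u : T.domain} (hu : shift T μ u = 0) (w : H) :
    inner ℂ (u : H) (res T z w) = (z - μ)⁻¹ • inner ℂ (u : H) w := by
  rcases eq_or_ne z μ with rfl | hne
  · have : (u : H) = 0 := by rw [← (res_spec hz).1 u, hu, map_zero]
    simp [this]
  obtain ⟨v, hv, rfl⟩ := (res_spec hz).2 w
  have hu' : T u = (μ : ℂ) • (u : H) := by
    rw [shift_apply, sub_eq_zero] at hu
    exact hu.symm
  rw [eq_inv_smul_iff₀ (sub_ne_zero.mpr hne), ← hv, shift_apply, inner_sub_right,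
    inner_smul_right, ← inner_symm_apply hT u v, hu', inner_smul_left, Complex.conj_ofReal,
    smul_eq_mul, sub_mul]

theorem inner_spectralProj_eq_zero {T : H →ₗ.[ℂ] H} (hT : IsSelfAdjoint T) {a b μ : ℝ}
    (ha : (a : ℂ) ∈ resSet T) (hb : (b : ℂ) ∈ resSet T) (hab : a < b) (hμ : μ ∉ Icc a b)
    {u : T.domain} (hu : shift T μ u = 0) (w : H) :
    inner ℂ (u : H) (spectralProj T a b w) = 0 := by
  have hr : 0 ≤ (b - a) / 2 := by linarith
  have hs := sphere_subset_resSet hT ha hb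
  have h := clm_circleProj (neg_I_mem_resSet hT) hr hs
    (innerSL ℂ (u : H) ∘L ContinuousLinearMap.apply ℂ H w)
  change inner ℂ (u : H) (circleProj T _ _ w) =
    (2 * Real.pi * I : ℂ)⁻¹ • ∮ z in C(_, _), inner ℂ (u : H) (res T z w) at h
  rw [spectralProj_eq_circleProj, h, circleIntegral.integral_congr hr
    fun z hz => inner_res_of_shift_eq_zero hT (hs hz) hu w, circleIntegral.integral_smul_const,
    circleIntegral_sub_inv_eq_zero hr (mt ofReal_mem_closedBall_iff.mp hμ), zero_smul, smul_zero]

/-- A spectral projection of finite rank projects onto the sum of the eigenspaces. -/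
theorem range_spectralProj_eq_eigensum {T : H →ₗ.[ℂ] H} (hT : IsSelfAdjoint T) {a b : ℝ}
    (ha : (a : ℂ) ∈ resSet T) (hb : (b : ℂ) ∈ resSet T) (hab : a < b)
    (hfin : FiniteDimensional ℂ (LinearMap.range (spectralProj T a b).toLinearMap)) :
    LinearMap.range (spectralProj T a b).toLinearMap = eigensum T a b := by
  refine le_antisymm ?_ (eigensum_le_range_spectralProj hT ha hb hab)
  set V : Submodule ℂ H := LinearMap.range (spectralProj T a b).toLinearMap with hV
  have hI := neg_I_mem_resSet hT
  have hKV : ∀ v ∈ V, (res T (-I)).toLinearMap v ∈ V := by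
    rintro _ ⟨v, rfl⟩
    exact ⟨res T (-I) v, (congrArg (fun L : H →L[ℂ] H => L v)
      (commute_res_spectralProj hT ha hb hab hI)).symm⟩
  -- On the finite dimensional `V`, injectivity of the resolvent gives surjectivity. Hence `V` lies
  -- in the domain and is invariant under `T`, and the spectral theorem for symmetric maps applies
  -- to the restriction `S`.
  have hKinj : Function.Injective ((res T (-I)).toLinearMap.restrict hKV) := by
    rw [injective_iff_map_eq_zero]
    intro v hv
    obtain ⟨u, hu, huv⟩ := (res_spec hI).2 v
    have h0 : res T (-I) v = 0 := congrArg Subtype.val hv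
    rw [h0, ZeroMemClass.coe_eq_zero] at hu
    rw [hu, map_zero] at huv
    exact Subtype.ext huv.symm
  have hdom : ∀ v ∈ V, ∃ u : T.domain, (u : H) = v ∧ T u ∈ V := by
    intro v hv
    obtain ⟨w, hw⟩ := LinearMap.injective_iff_surjective.mp hKinj ⟨v, hv⟩
    obtain ⟨u, hu, huw⟩ := (res_spec hI).2 w
    have huv : (u : H) = v := hu.trans (congrArg Subtype.val hw)
    refine ⟨u, huv, ?_⟩
    have : T u = -I • v - w := by
      rw [← huw, shift_apply, huv, sub_sub_cancel]
    rw [this]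
    exact V.sub_mem (V.smul_mem _ hv) w.2
  have hVdom : V ≤ T.domain := fun v hv => by
    obtain ⟨u, rfl, -⟩ := hdom v hv
    exact u.2
  let S : V →ₗ[ℂ] V := (T.toFun ∘ₗ Submodule.inclusion hVdom).codRestrict V fun v => by
    obtain ⟨u, hu, hu'⟩ := hdom v v.2
    have : Submodule.inclusion hVdom v = u := Subtype.ext hu.symm
    rw [LinearMap.comp_apply, this]
    exact hu'
  have hS : ∀ v : V, (S v : H) = T (Submodule.inclusion hVdom v) := fun v => rfl
  have hsymm : S.IsSymmetric := fun v w =>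
    inner_symm_apply hT (Submodule.inclusion hVdom v) (Submodule.inclusion hVdom w)
  have htop : (⨆ μ, Module.End.eigenspace S μ) = ⊤ :=
    Submodule.orthogonal_eq_bot_iff.mp hsymm.orthogonalComplement_iSup_eigenspaces_eq_bot
  have hle : (⨆ μ, Module.End.eigenspace S μ) ≤ (eigensum T a b).comap V.subtype := by
    refine iSup_le fun z v hv => ?_
    rcases eq_or_ne v 0 with rfl | hv0
    · exact Submodule.zero_mem _
    have hreal := hsymm.conj_eigenvalue_eq_self
      (Module.End.hasEigenvalue_of_hasEigenvector ⟨hv, hv0⟩)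
    obtain ⟨μ, rfl⟩ := Complex.conj_eq_iff_real.mp hreal
    have hshift : shift T μ (Submodule.inclusion hVdom v) = 0 := by
      rw [shift_apply, ← hS, Module.End.mem_eigenspace_iff.mp hv]
      exact sub_self _
    by_cases hμ : μ ∈ Icc a b
    · exact Submodule.mem_iSup_of_mem μ (Submodule.mem_iSup_of_mem hμ
        (mem_eigenspace_iff.mpr ⟨_, hshift, rfl⟩))
    -- An eigenvector with eigenvalue outside `[a, b]` is orthogonal to the range of the projection,
    -- which contains it.
    · exfalso
      obtain ⟨w, hw⟩ := v.2
      have h0 := inner_spectralProj_eq_zero hT ha hb hab hμ hshift w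
      change spectralProj T a b w = v at hw
      rw [hw] at h0
      exact hv0 (Subtype.ext (inner_self_eq_zero.mp h0))
  intro v hv
  exact hle (htop ▸ Submodule.mem_top : (⟨v, hv⟩ : V) ∈ _)

theorem finiteDimensional_range_spectralProj_of_le {T : H →ₗ.[ℂ] H} (hT : IsSelfAdjoint T)
    {a b a' b' : ℝ} (ha : (a : ℂ) ∈ resSet T) (hb : (b : ℂ) ∈ resSet T)
    (ha' : (a' : ℂ) ∈ resSet T) (hb' : (b' : ℂ) ∈ resSet T) (hab : a < b) (haa' : a' ≤ a)
    (hbb' : b ≤ b')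
    (hfin : FiniteDimensional ℂ (LinearMap.range (spectralProj T a' b').toLinearMap)) :
    FiniteDimensional ℂ (LinearMap.range (spectralProj T a b).toLinearMap) := by
  refine Submodule.finiteDimensional_of_le
    (S₂ := LinearMap.range (spectralProj T a' b').toLinearMap) ?_
  rintro _ ⟨v, rfl⟩
  exact ⟨spectralProj T a b v, congrArg (fun L : H →L[ℂ] H => L v)
    (spectralProj_mul_of_le hT ha hb ha' hb' hab haa' hbb')⟩

theorem finrank_eigensum_add {T : H →ₗ.[ℂ] H} (hT : IsSelfAdjoint T) {a b c : ℝ}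
    (hb : (b : ℂ) ∈ resSet T) (hc : (c : ℂ) ∈ resSet T) (hab : a ≤ b) (hbc : b < c)
    (hfin : FiniteDimensional ℂ (eigensum T a c)) :
    Module.finrank ℂ (eigensum T a c) =
      Module.finrank ℂ (eigensum T a b) + Module.finrank ℂ (eigensum T b c) := by
  have h1 : FiniteDimensional ℂ (eigensum T a b) :=
    Submodule.finiteDimensional_of_le (eigensum_mono (Icc_subset_Icc_right hbc.le))
  have h2 : FiniteDimensional ℂ (eigensum T b c) :=
    Submodule.finiteDimensional_of_le (eigensum_mono (Icc_subset_Icc_left hab))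
  have h := Submodule.finrank_sup_add_finrank_inf_eq (eigensum T a b) (eigensum T b c)
  rwa [eigensum_sup_eigensum T hab hbc.le, (disjoint_eigensum hT hb hc hbc).eq_bot,
    finrank_bot, add_zero] at h

end Eigensum

/-! ### Ranks of nearby idempotents -/

section FiniteRank

variable {H : Type*} [NormedAddCommGroup H] [InnerProductSpace ℂ H]

/-- If `P` kills a vector fixed by `Q`, then `P - Q` acts on it as `-1`, which a norm below one
allows only for the zero vector. -/
theorem injective_of_norm_sub_lt_one {P Q : H →L[ℂ] H} (hQ : IsIdempotentElem Q)
    (h : ‖P - Q‖ < 1) : Function.Injective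
      (P.toLinearMap.rangeRestrict ∘ₗ (LinearMap.range Q.toLinearMap).subtype) := by
  rw [injective_iff_map_eq_zero]
  rintro ⟨_, v, rfl⟩ hv
  have hP : P (Q v) = 0 := congrArg Subtype.val hv
  have hQ' : Q (Q v) = Q v := congrArg (fun L : H →L[ℂ] H => L v) hQ
  refine Subtype.ext ?_
  change Q v = 0
  have h1 : (P - Q) (Q v) = -Q v := by
    rw [sub_apply, hP, hQ', zero_sub]
  have h2 := (P - Q).le_opNorm (Q v)
  rw [h1, norm_neg] at h2
  by_contra hne
  have h3 : 0 < ‖Q v‖ := norm_pos_iff.mpr hne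
  nlinarith

theorem finiteDimensional_range_of_norm_sub_lt_one {P Q : H →L[ℂ] H} (hQ : IsIdempotentElem Q)
    (h : ‖P - Q‖ < 1) (hfin : FiniteDimensional ℂ (LinearMap.range P.toLinearMap)) :
    FiniteDimensional ℂ (LinearMap.range Q.toLinearMap) :=
  FiniteDimensional.of_injective _ (injective_of_norm_sub_lt_one hQ h)

theorem finrank_range_eq_of_norm_sub_lt_one {P Q : H →L[ℂ] H} (hP : IsIdempotentElem P)
    (hQ : IsIdempotentElem Q) (h : ‖P - Q‖ < 1)
    (hfin : FiniteDimensional ℂ (LinearMap.range P.toLinearMap)) :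
    Module.finrank ℂ (LinearMap.range P.toLinearMap) =
      Module.finrank ℂ (LinearMap.range Q.toLinearMap) := by
  have := finiteDimensional_range_of_norm_sub_lt_one hQ h hfin
  refine le_antisymm ?_ ?_
  · exact LinearMap.finrank_le_finrank_of_injective
      (injective_of_norm_sub_lt_one hP (by rwa [norm_sub_rev]))
  · exact LinearMap.finrank_le_finrank_of_injective (injective_of_norm_sub_lt_one hQ h)

end FiniteRank

end SpecFlow

end

noncomputable section

namespace SpecFlow

open scoped Topology

open Complex Metric Set Filter

/-! ### The resolvent of a selfadjoint Fredholm operator near zero -/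

section Fredholm

variable {H : Type*} [NormedAddCommGroup H] [InnerProductSpace ℂ H]

theorem mem_eigenspace_zero_iff {T : H →ₗ.[ℂ] H} {v : H} :
    v ∈ eigenspace T 0 ↔ ∃ u : T.domain, T u = 0 ∧ (u : H) = v := by
  simp [mem_eigenspace_iff, shift_apply]

theorem resFactor_zero_apply_of_mem {T : H →ₗ.[ℂ] H} (hT : -I ∈ resSet T) {v : H}
    (hv : v ∈ eigenspace T 0) : resFactor T 0 v = 0 := by
  obtain ⟨u, hu, rfl⟩ := mem_eigenspace_iff.mp hv
  rw [resFactor_apply, res_apply_of_shift_eq_zero hT hu, smul_smul]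
  simp

theorem res_apply_of_mem_eigenspace_zero {T : H →ₗ.[ℂ] H} (hT : -I ∈ resSet T) {v : H}
    (hv : v ∈ eigenspace T 0) : res T (-I) v = I • v := by
  obtain ⟨u, hu, rfl⟩ := mem_eigenspace_iff.mp hv
  rw [res_apply_of_shift_eq_zero hT hu]
  simp

theorem range_resFactor_zero {T : H →ₗ.[ℂ] H} (hT : -I ∈ resSet T) :
    LinearMap.range (resFactor T 0).toLinearMap = LinearMap.range T.toFun := by
  refine le_antisymm ?_ ?_
  · rintro _ ⟨v, rfl⟩
    obtain ⟨u, -, rfl⟩ := (res_spec hT).2 v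
    refine ⟨-u, ?_⟩
    change T.toFun (-u) = resFactor T 0 _
    rw [resFactor_shift hT, shift_apply, zero_smul, zero_sub, map_neg]
    rfl
  · rintro _ ⟨u, rfl⟩
    refine ⟨shift T (-I) (-u), ?_⟩
    change resFactor T 0 _ = _
    rw [resFactor_shift hT, shift_apply, zero_smul, zero_sub]
    change -T.toFun (-u) = _
    rw [map_neg, neg_neg]

variable [CompleteSpace H]

/-- Restricting to the orthogonal complement of the kernel makes `B` injective with the same range.
An algebraic complement of the range is finite dimensional, hence closed, so the closed complement
criterion applies. -/
theorem isClosed_range_of_finiteDimensional_quotient (B : H →L[ℂ] H)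
    (h : FiniteDimensional ℂ (H ⧸ LinearMap.range B.toLinearMap)) :
    IsClosed (LinearMap.range B.toLinearMap : Set H) := by
  obtain ⟨G, hG⟩ := (LinearMap.range B.toLinearMap).exists_isCompl
  have hGfin : FiniteDimensional ℂ G :=
    LinearEquiv.finiteDimensional (Submodule.quotientEquivOfIsCompl _ G hG)
  let N : Submodule ℂ H := LinearMap.ker B.toLinearMap
  have hN : CompleteSpace N := (ContinuousLinearMap.isClosed_ker B).completeSpace_coe
  let f : Nᗮ →L[ℂ] H := B ∘L Nᗮ.subtypeL
  have hker : LinearMap.ker f.toLinearMap = ⊥ := by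
    rw [Submodule.eq_bot_iff]
    intro v hv
    have hvN : (v : H) ∈ N := hv
    exact Subtype.ext (inner_self_eq_zero.mp (Submodule.inner_right_of_mem_orthogonal hvN v.2))
  have hrange : LinearMap.range f.toLinearMap = LinearMap.range B.toLinearMap := by
    refine le_antisymm ?_ ?_
    · rintro _ ⟨v, rfl⟩
      exact ⟨v, rfl⟩
    · rintro _ ⟨v, rfl⟩
      refine ⟨⟨v - N.starProjection v, N.sub_starProjection_mem_orthogonal v⟩, ?_⟩
      have h0 : B (N.starProjection v) = 0 := N.starProjection_apply_mem v
      change B (v - N.starProjection v) = B v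
      rw [map_sub, h0, sub_zero]
  rw [← hrange]
  exact ContinuousLinearMap.closed_complemented_range_of_isCompl_of_ker_eq_bot f G (by rwa [hrange])
    G.closed_of_finiteDimensional hker

/-- Kernel and range of `T` are orthogonal and, the range being closed, span `H`. The factor at `0`
has the range of `T` as its range and kills the kernel of `T`, so adding the projection onto that
kernel repairs both injectivity and surjectivity. -/
theorem isUnit_resFactor_zero_add_starProjection {T : H →ₗ.[ℂ] H} (hT : IsSelfAdjoint T)
    (hclosed : IsClosed (LinearMap.range T.toFun : Set H)) (N : Submodule ℂ H)
    [N.HasOrthogonalProjection] (hN : N = eigenspace T 0) :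
    IsUnit (resFactor T 0 + N.starProjection) := by
  have hI := neg_I_mem_resSet hT
  rw [ContinuousLinearMap.isUnit_iff_bijective]
  constructor
  · rw [injective_iff_map_eq_zero]
    intro v hv
    obtain ⟨u, hu, rfl⟩ := (res_spec hI).2 v
    change resFactor T 0 (shift T (-I) u) + N.starProjection (shift T (-I) u) = 0 at hv
    rw [resFactor_shift hI, shift_apply T 0, zero_smul, zero_sub, neg_add_eq_zero] at hv
    have hmem : T u ∈ eigenspace T 0 := by
      rw [hv, ← hN]
      exact N.starProjection_apply_mem _
    have hTu : T u = 0 := by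
      obtain ⟨w, hw, hwu⟩ := mem_eigenspace_zero_iff.mp hmem
      have h := inner_symm_apply hT w u
      rw [hw, inner_zero_left, hwu] at h
      exact inner_self_eq_zero.mp h.symm
    rw [hTu] at hv
    have hu2 : shift T (-I) u ∈ N := by
      rw [hN, shift_apply, hTu, sub_zero]
      exact Submodule.smul_mem _ _ (mem_eigenspace_zero_iff.mpr ⟨u, hTu, rfl⟩)
    rw [← Submodule.starProjection_eq_self_iff.mpr hu2, ← hv]
  · intro y
    have hcs : CompleteSpace (LinearMap.range T.toFun) := hclosed.completeSpace_coe
    have horth : (LinearMap.range T.toFun)ᗮ ≤ N := by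
      intro w hw
      obtain ⟨u, rfl, hu⟩ := exists_shift_eq_zero_of_orthogonal hT (z := 0) (w := w) fun u => by
        rw [shift_apply, zero_smul, zero_sub, inner_neg_right, neg_eq_zero]
        exact Submodule.inner_left_of_mem_orthogonal (LinearMap.mem_range_self T.toFun u) hw
      rw [map_zero] at hu
      rw [hN]
      exact mem_eigenspace_iff.mpr ⟨u, hu, rfl⟩
    have hy : y ∈ LinearMap.range (resFactor T 0).toLinearMap ⊔ N := by
      rw [range_resFactor_zero hI]
      refine sup_le_sup_left horth _ ?_
      rw [Submodule.sup_orthogonal_of_hasOrthogonalProjection]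
      exact Submodule.mem_top
    obtain ⟨_, ⟨x, rfl⟩, n, hn, rfl⟩ := Submodule.mem_sup.mp hy
    -- Correcting `x` within `N` leaves its image under the factor unchanged and makes the projected
    -- part exactly `n`.
    refine ⟨x + n - N.starProjection x, ?_⟩
    have h0 : ∀ m ∈ N, resFactor T 0 m = 0 := fun m hm =>
      resFactor_zero_apply_of_mem hI (hN ▸ hm)
    change resFactor T 0 (x + n - N.starProjection x) + N.starProjection (x + n - N.starProjection x)
      = resFactor T 0 x + n
    rw [map_sub, map_add, map_sub, map_add, h0 n hn, h0 _ (N.starProjection_apply_mem x),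
      Submodule.starProjection_eq_self_iff.mpr hn,
      Submodule.starProjection_eq_self_iff.mpr (N.starProjection_apply_mem x)]
    abel

theorem one_sub_add_smul_mul {A : Type*} [Ring A] [Algebra ℂ A] {P : A} (hP : P * P = P) {c : ℂ}
    (hc : c ≠ 0) : ((1 - P) + c • P) * ((1 - P) + c⁻¹ • P) = 1 := by
  simp only [mul_add, add_mul, mul_sub, sub_mul, mul_one, one_mul, smul_mul_assoc,
    mul_smul_comm, hP, sub_self, zero_add, inv_smul_smul₀ hc]
  abel

/-- A holomorphic part plus a singular part that starts with the finite rank `P`, which is all the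
contour integral needs. -/
theorem exists_isResolventAt_of_isFredholm {T : H →ₗ.[ℂ] H} (hT : IsSelfAdjoint T)
    (hF : IsFredholm T) :
    ∃ (P : H →L[ℂ] H) (C : ℂ → H →L[ℂ] H) (δ : ℝ), 0 < δ ∧
      FiniteDimensional ℂ (LinearMap.range P.toLinearMap) ∧
      (∀ z ∈ ball (0 : ℂ) δ, DifferentiableAt ℂ C z) ∧
      ∀ z ∈ ball (0 : ℂ) δ, z ≠ 0 →
        IsResolventAt T z (res T (-I) * (1 - P) * C z + P * (z⁻¹ • C z)) := by
  have hI := neg_I_mem_resSet hT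
  obtain ⟨-, hker, hcoker⟩ := hF
  have hclosed : IsClosed (LinearMap.range T.toFun : Set H) := by
    rw [← range_resFactor_zero hI] at hcoker ⊢
    exact isClosed_range_of_finiteDimensional_quotient _ hcoker
  let N : Submodule ℂ H := eigenspace T 0
  have hNfin : FiniteDimensional ℂ N := by
    have h : N = (LinearMap.ker T.toFun).map T.domain.subtype := by
      ext v
      rw [mem_eigenspace_zero_iff]
      simp [Submodule.mem_map]
    rw [h]
    infer_instance
  set P : H →L[ℂ] H := N.starProjection with hP
  set B : H →L[ℂ] H := resFactor T 0 with hB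
  set K : H →L[ℂ] H := res T (-I) with hK
  have hmem : ∀ v, P v ∈ N := N.starProjection_apply_mem
  have hPP : P * P = P := ContinuousLinearMap.ext fun v =>
    Submodule.starProjection_eq_self_iff.mpr (hmem v)
  have hBP : B * P = 0 := ContinuousLinearMap.ext fun v => resFactor_zero_apply_of_mem hI (hmem v)
  have hKP : K * P = I • P := ContinuousLinearMap.ext fun v =>
    res_apply_of_mem_eigenspace_zero hI (hmem v)
  -- Chosen so that `resFactor T z = C z * ((1 - P) + (I * z) • P)`: the degeneration at `z = 0`
  -- sits in the explicit second factor, while `C 0 = B + P` is invertible. The function required by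
  -- the statement is the inverse of this one.
  let C : ℂ → H →L[ℂ] H := fun z => B + P + z • (K * (1 - P))
  have hCd : Differentiable ℂ C := by
    unfold C
    fun_prop
  have hC0 : IsUnit (C 0) := by
    have h : C 0 = B + P := by simp [C]
    rw [h]
    exact isUnit_resFactor_zero_add_starProjection hT hclosed N rfl
  obtain ⟨δ, hδ, hsub⟩ := Metric.isOpen_iff.mp (Units.isOpen.preimage hCd.continuous) 0 hC0
  refine ⟨P, fun z => Ring.inverse (C z), δ, hδ, ?_, fun z hz => ?_, fun z hz hz0 => ?_⟩
  · refine Submodule.finiteDimensional_of_le (S₂ := N) ?_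
    rintro _ ⟨v, rfl⟩
    exact hmem v
  · exact (hCd z).inverse (hsub hz)
  · have hu : IsUnit (C z) := hsub hz
    have hCP : C z * P = P := by
      simp only [C, add_mul, smul_mul_assoc, mul_assoc, sub_mul, one_mul, hPP, hBP, sub_self,
        mul_zero, smul_zero, add_zero, zero_add]
    have hIz : I * z ≠ 0 := mul_ne_zero I_ne_zero hz0
    have hfac : resFactor T z = C z * ((1 - P) + (I * z) • P) := by
      have h1 : resFactor T z = B + z • K := by
        rw [hB, resFactor, resFactor, zero_add, add_smul]
        abel
      have h2 : (I * z) • P = z • (K * P) := by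
        rw [hKP, smul_smul, mul_comm]
      rw [mul_add, mul_sub, mul_one, mul_smul_comm, hCP, h1, h2]
      simp only [C, mul_sub, mul_one, smul_sub]
      abel
    have hG := isResolventAt_mul hI (z := z)
      (G := ((1 - P) + (I * z)⁻¹ • P) * Ring.inverse (C z))
      (by
        have hE := one_sub_add_smul_mul hPP (inv_ne_zero hIz)
        rw [inv_inv] at hE
        rw [hfac, mul_assoc, ← mul_assoc (Ring.inverse (C z)), Ring.inverse_mul_cancel _ hu,
          one_mul, hE])
      (by rw [hfac, mul_assoc, ← mul_assoc (1 - P + _), one_sub_add_smul_mul hPP hIz, one_mul,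
        Ring.mul_inverse_cancel _ hu])
    have hcoef : (I * z)⁻¹ * I = z⁻¹ := by
      rw [mul_inv, mul_comm I⁻¹, mul_assoc, inv_mul_cancel₀ I_ne_zero, mul_one]
    have hKE : K * ((1 - P) + (I * z)⁻¹ • P) = K * (1 - P) + z⁻¹ • P := by
      rw [mul_add, mul_smul_comm, hKP, smul_smul, hcoef]
    rwa [← mul_assoc, hKE, add_mul, smul_mul_assoc, ← mul_smul_comm] at hG

/-- By Cauchy the holomorphic part integrates to zero; the rest is `P` times an integral, so its
range lies in that of `P`. -/
theorem exists_finiteDimensional_range_spectralProj {T : H →ₗ.[ℂ] H} (hT : IsSelfAdjoint T)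
    (hF : IsFredholm T) :
    ∃ a : ℝ, 0 < a ∧ (a : ℂ) ∈ resSet T ∧ ((-a : ℝ) : ℂ) ∈ resSet T ∧
      FiniteDimensional ℂ (LinearMap.range (spectralProj T (-a) a).toLinearMap) := by
  obtain ⟨P, C, δ, hδ, hP, hC, hres⟩ := exists_isResolventAt_of_isFredholm hT hF
  have hr : 0 ≤ δ / 2 := by positivity
  have hmem : ∀ z : ℂ, ‖z‖ = δ / 2 → z ∈ ball (0 : ℂ) δ ∧ z ≠ 0 := by
    intro z hz
    refine ⟨by rw [mem_ball_zero_iff, hz]; linarith, fun h0 => ?_⟩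
    rw [h0, norm_zero] at hz
    linarith
  have hmem' : ∀ z ∈ sphere (0 : ℂ) (δ / 2), z ∈ ball (0 : ℂ) δ ∧ z ≠ 0 := fun z hz =>
    hmem z (mem_sphere_zero_iff_norm.mp hz)
  have hsub : closedBall (0 : ℂ) (δ / 2) ⊆ ball 0 δ := closedBall_subset_ball (by linarith)
  have hreal : ∀ x : ℝ, |x| = δ / 2 → (x : ℂ) ∈ resSet T := fun x hx => by
    have h := hmem x (by rw [Complex.norm_real, Real.norm_eq_abs, hx])
    exact ⟨_, hres x h.1 h.2⟩
  refine ⟨δ / 2, by positivity, hreal _ (abs_of_nonneg hr),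
    hreal _ (by rw [abs_neg, abs_of_nonneg hr]), ?_⟩
  have hcirc : spectralProj T (-(δ / 2)) (δ / 2) = circleProj T 0 (δ / 2) := by
    rw [spectralProj_eq_circleProj]
    congr 1
    · norm_num
    · ring
  have hCcont : ContinuousOn C (sphere 0 (δ / 2)) := fun z hz =>
    (hC z (hmem' z hz).1).continuousAt.continuousWithinAt
  have hint : CircleIntegrable (fun z => z⁻¹ • C z) 0 (δ / 2) :=
    ((continuousOn_id.inv₀ fun z hz => (hmem' z hz).2).smul hCcont).circleIntegrable hr
  have h0 : (∮ z in C(0, δ / 2), res T (-I) * (1 - P) * C z) = 0 :=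
    circleIntegral_eq_zero_of_differentiable_on_off_countable hr countable_empty
      (fun z hz => ((hC z (hsub hz)).const_mul _).continuousAt.continuousWithinAt)
      fun z hz => (hC z (hsub (ball_subset_closedBall hz.1))).const_mul _
  have hkey : (∮ z in C(0, δ / 2), res T z) = P * ∮ z in C(0, δ / 2), z⁻¹ • C z := by
    calc (∮ z in C(0, δ / 2), res T z)
        = ∮ z in C(0, δ / 2), (res T (-I) * (1 - P) * C z + P * (z⁻¹ • C z)) :=
          circleIntegral.integral_congr hr fun z hz => (hres z (hmem' z hz).1 (hmem' z hz).2).res_eq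
      _ = (∮ z in C(0, δ / 2), res T (-I) * (1 - P) * C z) +
            ∮ z in C(0, δ / 2), P * (z⁻¹ • C z) :=
          circleIntegral.integral_add ((continuousOn_const.mul hCcont).circleIntegrable hr)
            ((continuousOn_const.mul
              ((continuousOn_id.inv₀ fun z hz => (hmem' z hz).2).smul hCcont)).circleIntegrable hr)
      _ = P * ∮ z in C(0, δ / 2), z⁻¹ • C z := by
          rw [h0, zero_add]
          exact (clm_circleIntegral (ContinuousLinearMap.mul ℂ (H →L[ℂ] H) P) hint).symm
  refine Submodule.finiteDimensional_of_le (S₂ := LinearMap.range P.toLinearMap) ?_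
  rintro _ ⟨v, rfl⟩
  rw [hcirc, circleProj, hkey, ← mul_smul_comm]
  exact ⟨_, rfl⟩

end Fredholm

end SpecFlow

end

noncomputable section

namespace SpecFlow

open scoped Topology unitInterval

open Metric Set Filter

variable {H : Type*} [NormedAddCommGroup H] [InnerProductSpace ℂ H] [CompleteSpace H]

/-! ### Stability of spectral gaps and jumps of dimension -/

section Cut

/-- `T` has only finitely many eigenvalues of finite multiplicity, and no other spectrum, in
`[-a, a]`, and `± a` are in its resolvent set. -/
structure IsCut (T : CFsa H) (a : ℝ) : Prop where
  pos : 0 < a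
  mem : (a : ℂ) ∈ resSet T.op
  neg_mem : ((-a : ℝ) : ℂ) ∈ resSet T.op
  finite : FiniteDimensional ℂ (LinearMap.range (spectralProj T.op (-a) a).toLinearMap)

theorem exists_isCut (T : CFsa H) : ∃ a, IsCut T a :=
  let ⟨a, h1, h2, h3, h4⟩ := exists_finiteDimensional_range_spectralProj T.selfAdjoint T.fredholm
  ⟨a, h1, h2, h3, h4⟩

theorem eventually_norm_spectralProj_sub_lt_one {T : CFsa H} {a b : ℝ} (hab : a ≤ b)
    (ha : (a : ℂ) ∈ resSet T.op) (hb : (b : ℂ) ∈ resSet T.op) :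
    ∀ᶠ S : CFsa H in 𝓝 T, ‖spectralProj T.op a b - spectralProj S.op a b‖ < 1 := by
  have hopen := (isOpen_setOf_mem_resSet (H := H) a).inter (isOpen_setOf_mem_resSet (H := H) b)
  have hcont : ContinuousAt (fun S : CFsa H => spectralProj S.op a b) T :=
    (continuousOn_spectralProj hab).continuousAt (hopen.mem_nhds ⟨ha, hb⟩)
  have h := hcont.eventually (Metric.ball_mem_nhds _ one_pos)
  filter_upwards [h] with S hS
  rwa [dist_comm, dist_eq_norm] at hS

theorem isOpen_setOf_isCut (a : ℝ) : IsOpen {T : CFsa H | IsCut T a} := by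
  rw [isOpen_iff_mem_nhds]
  intro T hT
  have hlt : -a < a := by linarith [hT.pos]
  filter_upwards [(isOpen_setOf_mem_resSet _).mem_nhds hT.mem,
    (isOpen_setOf_mem_resSet _).mem_nhds hT.neg_mem,
    eventually_norm_spectralProj_sub_lt_one hlt.le hT.neg_mem hT.mem] with S h1 h2 h3
  exact ⟨hT.pos, h1, h2, finiteDimensional_range_of_norm_sub_lt_one
    (isIdempotentElem_spectralProj S.selfAdjoint h2 h1 hlt) h3 hT.finite⟩

theorem finrank_range_spectralProj_eq {X : Type*} [TopologicalSpace X] {A : X → CFsa H}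
    (hA : Continuous A) {S : Set X} (hS : IsPreconnected S) {a b : ℝ} (hab : a < b)
    (ha : ∀ t ∈ S, (a : ℂ) ∈ resSet (A t).op) (hb : ∀ t ∈ S, (b : ℂ) ∈ resSet (A t).op)
    (hfin : ∀ t ∈ S, FiniteDimensional ℂ (LinearMap.range (spectralProj (A t).op a b).toLinearMap))
    {s t : X} (hs : s ∈ S) (ht : t ∈ S) :
    Module.finrank ℂ (LinearMap.range (spectralProj (A s).op a b).toLinearMap) =
      Module.finrank ℂ (LinearMap.range (spectralProj (A t).op a b).toLinearMap) := by
  refine hS.constant (f := fun t =>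
    Module.finrank ℂ (LinearMap.range (spectralProj (A t).op a b).toLinearMap)) ?_ hs ht
  intro x hx
  refine tendsto_nhds_of_eventually_eq ?_
  filter_upwards [mem_nhdsWithin_of_mem_nhds (hA.continuousAt.eventually
    (eventually_norm_spectralProj_sub_lt_one hab.le (ha x hx) (hb x hx))), self_mem_nhdsWithin]
    with y hy hyS
  exact (finrank_range_eq_of_norm_sub_lt_one
    (isIdempotentElem_spectralProj (A x).selfAdjoint (ha x hx) (hb x hx) hab)
    (isIdempotentElem_spectralProj (A y).selfAdjoint (ha y hyS) (hb y hyS) hab) hy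
    (hfin x hx)).symm

theorem IsCut.finiteDimensional_range {T : CFsa H} {a c d : ℝ} (hT : IsCut T a)
    (hc : (c : ℂ) ∈ resSet T.op) (hd : (d : ℂ) ∈ resSet T.op) (hcd : c < d) (hac : -a ≤ c)
    (hda : d ≤ a) :
    FiniteDimensional ℂ (LinearMap.range (spectralProj T.op c d).toLinearMap) :=
  finiteDimensional_range_spectralProj_of_le T.selfAdjoint hc hd hT.neg_mem hT.mem hcd hac hda
    hT.finite

theorem IsCut.finrank_eigensum {T : CFsa H} {a c d : ℝ} (hT : IsCut T a)
    (hc : (c : ℂ) ∈ resSet T.op) (hd : (d : ℂ) ∈ resSet T.op) (hcd : c < d) (hac : -a ≤ c)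
    (hda : d ≤ a) : Module.finrank ℂ (eigensum T.op c d) =
      Module.finrank ℂ (LinearMap.range (spectralProj T.op c d).toLinearMap) := by
  rw [range_spectralProj_eq_eigensum T.selfAdjoint hc hd hcd
    (hT.finiteDimensional_range hc hd hcd hac hda)]

theorem IsCut.finiteDimensional_eigensum {T : CFsa H} {a : ℝ} (hT : IsCut T a) :
    FiniteDimensional ℂ (eigensum T.op 0 a) := by
  have hlt : -a < a := by linarith [hT.pos]
  have := hT.finite
  exact Submodule.finiteDimensional_of_le
    ((eigensum_mono (Icc_subset_Icc_left (by linarith))).trans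
      (eigensum_le_range_spectralProj T.selfAdjoint hT.neg_mem hT.mem hlt))

/-- The difference of the dimensions of `E_{[0,a]}` at the two ends of a piece of the path. -/
def dimJump (A : I → CFsa H) (a : ℝ) (s t : I) : ℤ :=
  (Module.finrank ℂ (eigensum (A t).op 0 a) : ℤ) - (Module.finrank ℂ (eigensum (A s).op 0 a) : ℤ)

theorem dimJump_self (A : I → CFsa H) (a : ℝ) (s : I) : dimJump A a s s = 0 :=
  sub_self _

theorem flowSum_eq_sum_dimJump (A : I → CFsa H) (n : ℕ) (pt : ℕ → I) (a : ℕ → ℝ) :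
    flowSum A n pt a = ∑ i ∈ Finset.range n, dimJump A (a (i + 1)) (pt i) (pt (i + 1)) := rfl

/-- `E_{[0,b]}` is the direct sum of `E_{[0,a]}` and `E_{[a,b]}`. Both ends of `[a, b]` stay in the
resolvent set, so the second summand has constant dimension along the piece. -/
theorem dimJump_eq_of_lt {A : I → CFsa H} (hA : Continuous A) {a b : ℝ} (hab : a < b) {s t : I}
    (hst : s ≤ t) (ha : ∀ x ∈ Icc s t, IsCut (A x) a) (hb : ∀ x ∈ Icc s t, IsCut (A x) b) :
    dimJump A a s t = dimJump A b s t := by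
  have hadd : ∀ x ∈ Icc s t, Module.finrank ℂ (eigensum (A x).op 0 b) =
      Module.finrank ℂ (eigensum (A x).op 0 a) +
        Module.finrank ℂ (LinearMap.range (spectralProj (A x).op a b).toLinearMap) := fun x hx => by
    rw [← (hb x hx).finrank_eigensum (ha x hx).mem (hb x hx).mem hab
      (by linarith [(ha x hx).pos]) le_rfl]
    exact finrank_eigensum_add (A x).selfAdjoint (ha x hx).mem (hb x hx).mem (ha x hx).pos.le hab
      (hb x hx).finiteDimensional_eigensum
  have hconst := finrank_range_spectralProj_eq hA isPreconnected_Icc hab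
    (fun x hx => (ha x hx).mem) (fun x hx => (hb x hx).mem)
    (fun x hx => (hb x hx).finiteDimensional_range (ha x hx).mem (hb x hx).mem hab
      (by linarith [(ha x hx).pos, (hb x hx).pos]) le_rfl)
    (left_mem_Icc.mpr hst) (right_mem_Icc.mpr hst)
  rw [dimJump, dimJump, hadd s (left_mem_Icc.mpr hst), hadd t (right_mem_Icc.mpr hst), hconst]
  push_cast
  ring

theorem dimJump_eq {A : I → CFsa H} (hA : Continuous A) {a b : ℝ} {s t : I}
    (hst : s ≤ t) (ha : ∀ x ∈ Icc s t, IsCut (A x) a) (hb : ∀ x ∈ Icc s t, IsCut (A x) b) :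
    dimJump A a s t = dimJump A b s t := by
  rcases lt_trichotomy a b with h | rfl | h
  · exact dimJump_eq_of_lt hA h hst ha hb
  · rfl
  · exact (dimJump_eq_of_lt hA h hst hb ha).symm

theorem dimJump_eq_zero_of_isInvertible {A : I → CFsa H} (hA : Continuous A) {a : ℝ} {s t : I}
    (hst : s ≤ t) (ha : ∀ x ∈ Icc s t, IsCut (A x) a) (hinv : ∀ x, IsInvertible (A x).op) :
    dimJump A a s t = 0 := by
  have h0 : ∀ x, ((0 : ℝ) : ℂ) ∈ resSet (A x).op := fun x => by
    rw [Complex.ofReal_zero]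
    exact (zero_mem_resSet_iff (neg_I_mem_resSet (A x).selfAdjoint)).mpr (hinv x)
  have hpos : 0 < a := (ha s (left_mem_Icc.mpr hst)).pos
  have hrank : ∀ x ∈ Icc s t, Module.finrank ℂ (eigensum (A x).op 0 a) =
      Module.finrank ℂ (LinearMap.range (spectralProj (A x).op 0 a).toLinearMap) := fun x hx =>
    (ha x hx).finrank_eigensum (h0 x) (ha x hx).mem hpos (by linarith) le_rfl
  have hconst := finrank_range_spectralProj_eq hA isPreconnected_Icc hpos
    (fun x _ => h0 x) (fun x hx => (ha x hx).mem)
    (fun x hx => (ha x hx).finiteDimensional_range (h0 x) (ha x hx).mem hpos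
      (by linarith) le_rfl)
    (left_mem_Icc.mpr hst) (right_mem_Icc.mpr hst)
  rw [dimJump, hrank s (left_mem_Icc.mpr hst), hrank t (right_mem_Icc.mpr hst), hconst, sub_self]

end Cut

/-! ### Existence of admissible data and independence of the choice -/

section Admissible

variable {A : I → CFsa H}

theorem IsAdmissible.isCut {n : ℕ} {pt : ℕ → I} {a : ℕ → ℝ} (h : IsAdmissible A n pt a) {i : ℕ}
    (hi : i < n) : ∀ t ∈ Icc (pt i) (pt (i + 1)), IsCut (A t) (a (i + 1)) := fun t ht =>
  ⟨h.pos i hi, (h.mem_resSet i hi t ht).1, (h.mem_resSet i hi t ht).2, h.rank_finite i hi t ht⟩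

/-- For a continuous path, continuity and constancy of rank are automatic once each piece consists
of cuts. -/
theorem isAdmissible_of_isCut (hA : Continuous A) {n : ℕ} {pt : ℕ → I} {a : ℕ → ℝ}
    (h0 : pt 0 = 0) (h1 : pt n = 1) (hle : ∀ i < n, pt i ≤ pt (i + 1))
    (hcut : ∀ i < n, ∀ t ∈ Icc (pt i) (pt (i + 1)), IsCut (A t) (a (i + 1))) :
    IsAdmissible A n pt a := by
  have hpos : ∀ i < n, 0 < a (i + 1) := fun i hi =>
    (hcut i hi _ (left_mem_Icc.mpr (hle i hi))).pos
  have hlt : ∀ i < n, -a (i + 1) < a (i + 1) := fun i hi => by linarith [hpos i hi]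
  exact
    { pt_zero := h0
      pt_last := h1
      pt_le := hle
      pos := hpos
      mem_resSet := fun i hi t ht => ⟨(hcut i hi t ht).mem, (hcut i hi t ht).neg_mem⟩
      continuousOn := fun i hi => (continuousOn_spectralProj (hlt i hi).le).comp hA.continuousOn
        fun t ht => ⟨(hcut i hi t ht).neg_mem, (hcut i hi t ht).mem⟩
      rank_finite := fun i hi t ht => (hcut i hi t ht).finite
      rank_const := fun i hi s hs t ht => finrank_range_spectralProj_eq hA isPreconnected_Icc
        (hlt i hi) (fun x hx => (hcut i hi x hx).neg_mem) (fun x hx => (hcut i hi x hx).mem)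
        (fun x hx => (hcut i hi x hx).finite) hs ht }

theorem exists_isAdmissible (hA : Continuous A) :
    ∃ (n : ℕ) (pt : ℕ → I) (a : ℕ → ℝ), IsAdmissible A n pt a := by
  obtain ⟨pt, h0, hmono, ⟨n, hn⟩, hsub⟩ := exists_monotone_Icc_subset_open_cover_unitInterval
    (c := fun a : ℝ => A ⁻¹' {T | IsCut T a}) (fun a => (isOpen_setOf_isCut a).preimage hA)
    fun t _ => mem_iUnion.mpr (exists_isCut (A t))
  choose f hf using hsub
  -- The number belonging to piece `i` is read off at index `i + 1`, hence the shift.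
  exact ⟨n, pt, fun i => f (i - 1), isAdmissible_of_isCut hA h0 (hn n le_rfl)
    (fun i _ => hmono i.le_succ) fun i _ t ht => hf i ht⟩

/-- Clamping each interval into the other gives their intersection on both sides when they meet,
where both numbers are cuts. Otherwise both clamped intervals shrink to points and both jumps
vanish. -/
theorem dimJump_clamp_eq (hA : Continuous A) {a b : ℝ} {p p' q q' : I} (hp : p ≤ p') (hq : q ≤ q')
    (ha : ∀ x ∈ Icc p p', IsCut (A x) a) (hb : ∀ x ∈ Icc q q', IsCut (A x) b) :
    dimJump A a (max p (min p' q)) (max p (min p' q')) =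
      dimJump A b (max q (min q' p)) (max q (min q' p')) := by
  rcases lt_or_ge p' q with h1 | h1
  · rw [min_eq_left h1.le, min_eq_left (h1.le.trans hq), min_eq_right (hp.trans (h1.le.trans hq)),
      min_eq_right (h1.le.trans hq), max_eq_left (hp.trans h1.le), max_eq_left h1.le,
      dimJump_self, dimJump_self]
  rcases lt_or_ge q' p with h2 | h2
  · rw [min_eq_left h2.le, min_eq_left (h2.le.trans hp), min_eq_right (hq.trans (h2.le.trans hp)),
      min_eq_right (h2.le.trans hp), max_eq_left (hq.trans h2.le), max_eq_left h2.le,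
      dimJump_self, dimJump_self]
  rw [min_eq_right h1, min_eq_right h2, max_eq_right (le_min hp h2), max_eq_right (le_min hq h1),
    max_comm q p, min_comm q' p']
  refine dimJump_eq hA (max_le (le_min hp h2) (le_min h1 hq)) (fun x hx => ha x ?_)
    fun x hx => hb x ?_
  · exact ⟨(le_max_left _ _).trans hx.1, hx.2.trans (min_le_left _ _)⟩
  · exact ⟨(le_max_right _ _).trans hx.1, hx.2.trans (min_le_right _ _)⟩

/-- A telescoping sum whose clamped end values are `p` and `p'`. It replaces the construction of a
common refinement of two subdivisions. -/
theorem dimJump_eq_sum_clamp (A : I → CFsa H) (a : ℝ) {p p' : I} (hp : p ≤ p') {m : ℕ} {q : ℕ → I}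
    (h0 : q 0 = 0) (h1 : q m = 1) : dimJump A a p p' =
      ∑ j ∈ Finset.range m, dimJump A a (max p (min p' (q j))) (max p (min p' (q (j + 1)))) := by
  simp only [dimJump]
  rw [Finset.sum_range_sub
    (fun j => (Module.finrank ℂ (eigensum (A (max p (min p' (q j)))).op 0 a) : ℤ)) m, h0, h1,
    min_eq_left unitInterval.le_one', max_eq_right hp, min_eq_right unitInterval.nonneg',
    max_eq_left unitInterval.nonneg']

theorem flowSum_eq_of_isAdmissible (hA : Continuous A) {n m : ℕ} {p q : ℕ → I} {a b : ℕ → ℝ}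
    (ha : IsAdmissible A n p a) (hb : IsAdmissible A m q b) :
    flowSum A n p a = flowSum A m q b := by
  rw [flowSum_eq_sum_dimJump, flowSum_eq_sum_dimJump,
    Finset.sum_congr rfl fun i hi => dimJump_eq_sum_clamp A _ (ha.pt_le i (Finset.mem_range.mp hi))
      hb.pt_zero hb.pt_last,
    Finset.sum_congr rfl fun j hj => dimJump_eq_sum_clamp A _ (hb.pt_le j (Finset.mem_range.mp hj))
      ha.pt_zero ha.pt_last, Finset.sum_comm]
  refine Finset.sum_congr rfl fun j hj => Finset.sum_congr rfl fun i hi => ?_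
  rw [Finset.mem_range] at hi hj
  exact dimJump_clamp_eq hA (ha.pt_le i hi) (hb.pt_le j hj) (ha.isCut hi) (hb.isCut hj)

theorem flowSum_eq_sfl (hA : Continuous A) {n : ℕ} {pt : ℕ → I} {a : ℕ → ℝ}
    (h : IsAdmissible A n pt a) : flowSum A n pt a = sfl A := by
  have hex : ∃ k : ℤ, ∃ (n : ℕ) (pt : ℕ → I) (a : ℕ → ℝ), IsAdmissible A n pt a ∧
      k = flowSum A n pt a := ⟨_, n, pt, a, h, rfl⟩
  obtain ⟨m, q, b, hb, hk⟩ := hex.choose_spec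
  rw [sfl, dif_pos hex, hk]
  exact flowSum_eq_of_isAdmissible hA h hb

end Admissible

/-! ### Invertible paths, reversal and concatenation -/

section Operations

theorem sfl_eq_zero_of_isInvertible {A : I → CFsa H} (hA : Continuous A)
    (hinv : ∀ t, IsInvertible (A t).op) : sfl A = 0 := by
  obtain ⟨n, pt, a, h⟩ := exists_isAdmissible hA
  rw [← flowSum_eq_sfl hA h, flowSum_eq_sum_dimJump]
  refine Finset.sum_eq_zero fun i hi => ?_
  rw [Finset.mem_range] at hi
  exact dimJump_eq_zero_of_isInvertible hA (h.pt_le i hi) (h.isCut hi) hinv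

theorem sfl_symm {A : I → CFsa H} (hA : Continuous A) :
    sfl (fun t => A (unitInterval.symm t)) = -sfl A := by
  obtain ⟨n, pt, a, h⟩ := exists_isAdmissible hA
  have hA' : Continuous fun t => A (unitInterval.symm t) :=
    hA.comp unitInterval.continuous_symm
  have hidx : ∀ i < n, n - i = n - 1 - i + 1 ∧ n - (i + 1) = n - 1 - i ∧ n - 1 - i < n ∧
      n + 1 - (i + 1) = n - 1 - i + 1 := fun i hi => by omega
  have hadm : IsAdmissible (fun t => A (unitInterval.symm t)) n
      -- Points are indexed from `0` to `n` and numbers from `1` to `n`, so the two reversals differ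
      -- by one.
      (fun i => unitInterval.symm (pt (n - i))) (fun i => a (n + 1 - i)) := by
    refine isAdmissible_of_isCut hA' ?_ ?_ (fun i hi => ?_) fun i hi t ht => ?_
    · simp [h.pt_last]
    · simp [h.pt_zero]
    · obtain ⟨h1, h2, h3, -⟩ := hidx i hi
      rw [h1, h2, unitInterval.symm_le_symm]
      exact h.pt_le _ h3
    · obtain ⟨h1, h2, h3, h4⟩ := hidx i hi
      rw [h1, h2] at ht
      rw [h4]
      refine h.isCut h3 _ ⟨?_, ?_⟩
      · rw [← unitInterval.symm_le_symm, unitInterval.symm_symm]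
        exact ht.2
      · rw [← unitInterval.symm_le_symm, unitInterval.symm_symm]
        exact ht.1
  rw [← flowSum_eq_sfl hA' hadm, ← flowSum_eq_sfl hA h, flowSum_eq_sum_dimJump,
    flowSum_eq_sum_dimJump, ← Finset.sum_range_reflect, ← Finset.sum_neg_distrib]
  refine Finset.sum_congr rfl fun i hi => ?_
  rw [Finset.mem_range] at hi
  have h1 : n - (n - 1 - i) = i + 1 := by omega
  have h2 : n - (n - 1 - i + 1) = i := by omega
  have h3 : n + 1 - (n - 1 - i + 1) = i + 1 := by omega
  rw [h1, h2, h3, dimJump, dimJump, unitInterval.symm_symm, unitInterval.symm_symm, neg_sub]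

/-- The point `x / 2` of the unit interval. -/
def leftHalf (x : I) : I := ⟨x / 2, by constructor <;> linarith [x.2.1, x.2.2]⟩

/-- The point `(1 + x) / 2` of the unit interval. -/
def rightHalf (x : I) : I := ⟨(1 + x) / 2, by constructor <;> linarith [x.2.1, x.2.2]⟩

theorem coe_leftHalf (x : I) : (leftHalf x : ℝ) = x / 2 := rfl

theorem coe_rightHalf (x : I) : (rightHalf x : ℝ) = (1 + x) / 2 := rfl

theorem leftHalf_one : leftHalf 1 = rightHalf 0 :=
  Subtype.ext (by simp [coe_leftHalf, coe_rightHalf])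

theorem trans_leftHalf {X : Type*} [TopologicalSpace X] {x y z : X} (γ : Path x y) (γ' : Path y z)
    (t : I) : γ.trans γ' (leftHalf t) = γ t := by
  rw [Path.trans_apply, dif_pos (by rw [coe_leftHalf]; linarith [t.2.2])]
  exact congrArg γ (Subtype.ext (mul_div_cancel₀ _ two_ne_zero))

theorem trans_rightHalf {X : Type*} [TopologicalSpace X] {x y z : X} (γ : Path x y) (γ' : Path y z)
    (t : I) : γ.trans γ' (rightHalf t) = γ' t := by
  -- At `t = 0` the midpoint falls under the first branch of the concatenation, so the common
  -- endpoint must be used.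
  rcases eq_or_ne t 0 with rfl | ht
  · rw [← leftHalf_one, trans_leftHalf, γ.target, γ'.source]
  · have hpos : 0 < (t : ℝ) := unitInterval.pos_iff_ne_zero.mpr ht
    rw [Path.trans_apply, dif_neg (by rw [coe_rightHalf]; linarith)]
    refine congrArg γ' (Subtype.ext ?_)
    change 2 * ((1 + (t : ℝ)) / 2) - 1 = t
    ring

theorem exists_leftHalf_of_mem_Icc {p q t : I} (ht : t ∈ Icc (leftHalf p) (leftHalf q)) :
    ∃ x ∈ Icc p q, leftHalf x = t := by
  have h1 : (p : ℝ) / 2 ≤ t := ht.1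
  have h2 : (t : ℝ) ≤ q / 2 := ht.2
  refine ⟨⟨2 * t, by constructor <;> linarith [q.2.2, t.2.1]⟩, ⟨?_, ?_⟩, Subtype.ext ?_⟩
  · change (p : ℝ) ≤ 2 * t
    linarith
  · change 2 * (t : ℝ) ≤ q
    linarith
  · exact mul_div_cancel_left₀ _ two_ne_zero

theorem exists_rightHalf_of_mem_Icc {p q t : I} (ht : t ∈ Icc (rightHalf p) (rightHalf q)) :
    ∃ x ∈ Icc p q, rightHalf x = t := by
  have h1 : (1 + (p : ℝ)) / 2 ≤ t := ht.1
  have h2 : (t : ℝ) ≤ (1 + q) / 2 := ht.2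
  refine ⟨⟨2 * t - 1, by constructor <;> linarith [q.2.2, p.2.1]⟩, ⟨?_, ?_⟩, Subtype.ext ?_⟩
  · change (p : ℝ) ≤ 2 * t - 1
    linarith
  · change 2 * (t : ℝ) - 1 ≤ q
    linarith
  · change (1 + (2 * (t : ℝ) - 1)) / 2 = t
    ring

theorem sfl_trans {T₀ T₁ T₂ : CFsa H} (A₁ : Path T₀ T₁) (A₂ : Path T₁ T₂) :
    sfl (A₁.trans A₂) = sfl A₁ + sfl A₂ := by
  obtain ⟨n, p, a, ha⟩ := exists_isAdmissible A₁.continuous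
  obtain ⟨m, q, b, hb⟩ := exists_isAdmissible A₂.continuous
  -- At `i = n` the two formulas agree, both giving the midpoint. The numbers `c` switch one index
  -- later, because `a n` still belongs to the last piece of the first path.
  let r : ℕ → I := fun i => if i < n then leftHalf (p i) else rightHalf (q (i - n))
  let c : ℕ → ℝ := fun i => if i < n + 1 then a i else b (i - n)
  have hr1 : ∀ i ≤ n, r i = leftHalf (p i) := by
    intro i hi
    rcases hi.lt_or_eq with h | rfl
    · exact if_pos h
    · rw [ha.pt_last, leftHalf_one, ← hb.pt_zero]
      simp [r]
  have hr2 : ∀ j, r (n + j) = rightHalf (q j) := fun j => by simp [r]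
  have hc1 : ∀ i < n, c (i + 1) = a (i + 1) := fun i hi => if_pos (by omega)
  have hc2 : ∀ j, c (n + j + 1) = b (j + 1) := fun j => by
    have h : n + j + 1 - n = j + 1 := by omega
    simp only [c, h]
    exact if_neg (by omega)
  have hadm : IsAdmissible (A₁.trans A₂) (n + m) r c := by
    refine isAdmissible_of_isCut (A₁.trans A₂).continuous ?_ ?_ (fun i hi => ?_)
      fun i hi t ht => ?_
    · rw [hr1 0 n.zero_le, ha.pt_zero]
      exact Subtype.ext (by simp [coe_leftHalf])
    · rw [hr2, hb.pt_last]
      exact Subtype.ext (by rw [coe_rightHalf]; norm_num)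
    · rcases lt_or_ge i n with h | h
      · rw [hr1 i h.le, hr1 (i + 1) h, ← Subtype.coe_le_coe, coe_leftHalf, coe_leftHalf]
        have : (p i : ℝ) ≤ p (i + 1) := ha.pt_le i h
        linarith
      · obtain ⟨j, rfl⟩ := Nat.exists_eq_add_of_le h
        rw [add_assoc, hr2, hr2, ← Subtype.coe_le_coe, coe_rightHalf, coe_rightHalf]
        have : (q j : ℝ) ≤ q (j + 1) := hb.pt_le j (by omega)
        linarith
    · rcases lt_or_ge i n with h | h
      · rw [hr1 i h.le, hr1 (i + 1) h] at ht
        obtain ⟨x, hx, rfl⟩ := exists_leftHalf_of_mem_Icc ht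
        rw [trans_leftHalf, hc1 i h]
        exact ha.isCut h x hx
      · obtain ⟨j, rfl⟩ := Nat.exists_eq_add_of_le h
        rw [add_assoc, hr2, hr2] at ht
        obtain ⟨x, hx, rfl⟩ := exists_rightHalf_of_mem_Icc ht
        rw [trans_rightHalf, hc2]
        exact hb.isCut (by omega) x hx
  rw [← flowSum_eq_sfl (A₁.trans A₂).continuous hadm, ← flowSum_eq_sfl A₁.continuous ha,
    ← flowSum_eq_sfl A₂.continuous hb, flowSum_eq_sum_dimJump, flowSum_eq_sum_dimJump,
    flowSum_eq_sum_dimJump, Finset.sum_range_add]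
  congr 1
  · refine Finset.sum_congr rfl fun i hi => ?_
    rw [Finset.mem_range] at hi
    rw [hr1 i hi.le, hr1 (i + 1) hi, hc1 i hi, dimJump, trans_leftHalf, trans_leftHalf, dimJump]
  · refine Finset.sum_congr rfl fun j _ => ?_
    rw [hc2, add_assoc, hr2, hr2, dimJump, trans_rightHalf, trans_rightHalf, dimJump]

end Operations

end SpecFlow

end

theorem mainTheorem3 {H : Type*} [NormedAddCommGroup H] [InnerProductSpace ℂ H] [CompleteSpace H] :
    -- the spectral flow of a gap continuous path is well defined
    (∀ {T₀ T₁ : SpecFlow.CFsa H} (A : Path T₀ T₁),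
      (∃ (n : ℕ) (pt : ℕ → unitInterval) (a : ℕ → ℝ), SpecFlow.IsAdmissible A n pt a) ∧
      (∀ (n : ℕ) (pt : ℕ → unitInterval) (a : ℕ → ℝ), SpecFlow.IsAdmissible A n pt a →
        SpecFlow.flowSum A n pt a = SpecFlow.sfl A)) ∧
    -- (i) concatenation
    (∀ {T₀ T₁ T₂ : SpecFlow.CFsa H} (A₁ : Path T₀ T₁) (A₂ : Path T₁ T₂),
      SpecFlow.sfl (A₁.trans A₂) = SpecFlow.sfl A₁ + SpecFlow.sfl A₂) ∧
    -- (ii) reversal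
    (∀ {T₀ T₁ : SpecFlow.CFsa H} (A : Path T₀ T₁),
      SpecFlow.sfl (fun t => A (unitInterval.symm t)) = -SpecFlow.sfl A) ∧
    -- (iii) paths of invertible operators
    (∀ {T₀ T₁ : SpecFlow.CFsa H} (A : Path T₀ T₁),
      (∀ t, SpecFlow.IsInvertible (A t).op) → SpecFlow.sfl A = 0) := by
  refine ⟨fun A => ⟨SpecFlow.exists_isAdmissible A.continuous, fun _ _ _ h =>
    SpecFlow.flowSum_eq_sfl A.continuous h⟩, fun A₁ A₂ => SpecFlow.sfl_trans A₁ A₂,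
    fun A => SpecFlow.sfl_symm A.continuous,
    fun A h => SpecFlow.sfl_eq_zero_of_isInvertible A.continuous h⟩
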